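/- **Conventions.** Let $(N,h)$ be a smooth semi-Riemannian manifold with Levi-Civita connection $\nabla$. Put $R_{ijkl}=h(R(\partial_i,\partial_j)\partial_l,\partial_k)$, where $R(X,Y)=[\nabla_X,\nabla_Y]-\nabla_{[X,Y]}$ (so that $R_{ijij}\ge 0$ on a round sphere), and $S_{jk}=h^{il}R_{ijkl}$. For symmetric $(0,2)$-tensors $A,B$ let $$(A\wedge B)_{ijkl}=A_{il}B_{jk}+A_{jk}B_{il}-A_{ik}B_{jl}-A_{jl}B_{ik}.$$ For smooth 1-forms $\Pi,\Phi$, the manifold is *weakly generalized recurrent* ($WGK$) with $(\Pi,\Phi)$ if $$\nabla R=\Pi\otimes R+\Phi\otimes (S\wedge S)\qquad (*)$$ holds at every point of the set $U$ of those $x$ such that for no smooth 1-form $\xi$ does $\nabla R=\xi\otimes R$ hold at $x$. **Setting.** Let $1\le p<n$, let $(\overline M,\overline g)$ and $(\widetilde M,\widetilde g)$ be smooth semi-Riemannian manifolds of dimensions $p$ and $n-p$, let $f>0$ be a smooth function on $\overline M$, and let $M=\overline M\times_f\widetilde M$ be $\overline M\times\widetilde M$ with the metric $g=\pi^*\overline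 g+(f\circ\pi)\,\sigma^*\widetilde g$, where $\pi,\sigma$ are the projections. A bar or a tilde marks the quantities of $\overline g$ or $\widetilde g$; for a 1-form $\Omega$ on $M$, $\overline\Omega$ and $\widetilde\Omega$ denote its components along the base and the fiber (both depend on the point of $M$). Put, on $\overline M$, with $f_a=\partial_af$ and $f^a=\overline g^{ab}f_b$, $$T_{ab}=-\frac1{2f}\Bigl(\overline\nabla_bf_a-\frac1{2f}f_af_b\Bigr),\quad P=\frac{1}{4f^2}\,\overline g^{ab}f_af_b,\quad Q=f\bigl((n-p-1)P-\overline g^{ab}T_{ab}\bigr),$$ and $\widetilde G=\frac12\,\widetilde g\wedge\widetilde g$. **Statement.** Let $\Pi,\Phi$ be smooth 1-forms on $M$. At every point of $M$, equation $(*)$ for $M$ holds if and only if the following identities hold simultaneously at that point: 1. (i) $\overline\nabla\,\overline R=\overline\Pi\otimes\overline R+\overline\Phi\otimes\overline S\wedge\overline S-2(n-p)\overline\Phi\otimes(\overline S\wedge T)+(n-p)^2\,\overline\Phi\otimes T\wedge T$, (ii) $-\widetilde\Pi\otimes\overline R=\widetilde\Phi\otimes\overline S\wedge\overline S-2(n-p)\widetilde\Phi\otimes(\overline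 S\wedge T)+(n-p)^2\,\widetilde\Phi\otimes T\wedge T$; 2. (i) $-(df+f\overline\Pi)\otimes\widetilde R=\overline\Phi\otimes\widetilde S\wedge\widetilde S+2Q\overline\Phi\otimes\widetilde g\wedge\widetilde S+\bigl(\tfrac12f^2(P\overline\Pi-dP)+Q^2\overline\Phi\bigr)\otimes\widetilde g\wedge\widetilde g$, (ii) $f\,\widetilde\nabla\widetilde R=f\,\widetilde\Pi\otimes\widetilde R+\widetilde\Phi\otimes\widetilde S\wedge\widetilde S+2Q\widetilde\Phi\otimes\widetilde g\wedge\widetilde S+\bigl(\tfrac12f^2P\,\widetilde\Pi+Q^2\widetilde\Phi\bigr)\otimes\widetilde g\wedge\widetilde g$; 3. (i) $2\overline\Phi\otimes(\overline S-(n-p)T)\otimes\widetilde S=-\bigl[f(\overline\nabla T-\overline\Pi\otimes T)+2Q\overline\Phi\otimes(\overline S-(n-p)T)\bigr]\otimes\widetilde g$, (ii) $2\widetilde\Phi\otimes(\overline S-(n-p)T)\otimes\widetilde S=-\bigl[-f\,\widetilde\Pi\otimes T+2Q\widetilde\Phi\otimes(\overline S-(n-p)T)\bigr]\otimes\widetilde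 g$; 4. (i) $f^d\,\overline R_{abcd}=-(f_aT_{bc}-f_bT_{ac})$, (ii) $df\otimes\widetilde R=f^2\,dP\otimes\widetilde G$. In particular, $M$ is $WGK$ with $(\Pi,\Phi)$ if and only if all these identities hold at every point of the set $U$ of $M$ (and $(*)$ holds on all of $M$ if and only if they hold on all of $M$). -/

import Mathlib

open scoped Manifold ContDiff Bundle
open Bundle

noncomputable section

namespace WarpedProduct

/-! ## Tensor calculus in coordinates

`G : E → E →L[ℝ] E →L[ℝ] ℝ` is a symmetric nondegenerate form depending on a point of the
finite-dimensional coordinate space `E`; vectors of `E` stand for vector fields with constant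
components, so that evaluating on basis vectors gives the usual index expressions. -/

namespace Coord

variable {E : Type*} [NormedAddCommGroup E] [NormedSpace ℝ E]

/-- Raising an index: the vector `v` with `G u v = α`. -/
def sharp (G : E → E →L[ℝ] E →L[ℝ] ℝ) (u : E) (α : E →L[ℝ] ℝ) : E :=
  (G u).inverse α

/-- Christoffel symbols of the first kind, as a covector in `Z`:
`(∂_X G(Y, Z) + ∂_Y G(X, Z) - ∂_Z G(X, Y)) / 2`. -/
def koszul (G : E → E →L[ℝ] E →L[ℝ] ℝ) (u X Y : E) : E →L[ℝ] ℝ :=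
  (1 / 2 : ℝ) • (fderiv ℝ (fun v => G v Y) u X + fderiv ℝ (fun v => G v X) u Y
    - fderiv ℝ (fun v => G v X Y) u)

/-- Christoffel symbols of the second kind: `Γ(X, Y)` is the Levi-Civita derivative of the
constant field `Y` along the constant field `X`. -/
def Gam (G : E → E →L[ℝ] E →L[ℝ] ℝ) (u X Y : E) : E :=
  sharp G u (koszul G u X Y)

/-- The curvature operator `R(X, Y) Z = ∇_X ∇_Y Z - ∇_Y ∇_X Z` on constant fields. -/
def curv (G : E → E →L[ℝ] E →L[ℝ] ℝ) (u X Y Z : E) : E :=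
  fderiv ℝ (fun v => Gam G v Y Z) u X - fderiv ℝ (fun v => Gam G v X Z) u Y
    + Gam G u X (Gam G u Y Z) - Gam G u Y (Gam G u X Z)

/-- The covariant curvature tensor `R(X, Y, Z, W) = g(R(X, Y) W, Z)`. With this sign the
components `R(X, Y, X, Y)` of a round sphere are nonnegative. -/
def riem (G : E → E →L[ℝ] E →L[ℝ] ℝ) (u X Y Z W : E) : ℝ :=
  G u (curv G u X Y W) Z

/-- The metric contraction `g^{ij} A_{ij}` of a bilinear function `A`, computed in a basis; here
`g^{ij}` is the `i`-th coordinate of the `j`-th dual basis covector with its index raised. -/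
def contract [FiniteDimensional ℝ E] (G : E → E →L[ℝ] E →L[ℝ] ℝ) (u : E) (A : E → E → ℝ) : ℝ :=
  let b := Module.finBasis ℝ E
  ∑ i, ∑ j, b.repr (sharp G u (LinearMap.toContinuousLinearMap (b.coord j))) i * A (b i) (b j)

/-- The Ricci tensor `S_{jk} = g^{il} R_{ijkl}`. -/
def ric [FiniteDimensional ℝ E] (G : E → E →L[ℝ] E →L[ℝ] ℝ) (u Y Z : E) : ℝ :=
  contract G u (fun X W => riem G u X Y Z W)

/-- The covariant derivative `(∇_D R)(X, Y, Z, W)` of the curvature tensor. -/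
def nablaRiem (G : E → E →L[ℝ] E →L[ℝ] ℝ) (u D X Y Z W : E) : ℝ :=
  fderiv ℝ (fun v => riem G v X Y Z W) u D
    - riem G u (Gam G u D X) Y Z W - riem G u X (Gam G u D Y) Z W
    - riem G u X Y (Gam G u D Z) W - riem G u X Y Z (Gam G u D W)

/-- The differential of a function. -/
def dF (f : E → ℝ) (u X : E) : ℝ :=
  fderiv ℝ f u X

/-- The gradient of a function. -/
def grad (G : E → E →L[ℝ] E →L[ℝ] ℝ) (f : E → ℝ) (u : E) : E :=
  sharp G u (fderiv ℝ f u)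

/-- The Hessian `(∇ df)(X, Y) = ∂_X ∂_Y f - df(Γ(X, Y))`. -/
def hess (G : E → E →L[ℝ] E →L[ℝ] ℝ) (f : E → ℝ) (u X Y : E) : ℝ :=
  fderiv ℝ (fun v => fderiv ℝ f v Y) u X - fderiv ℝ f u (Gam G u X Y)

/-- `T = - (∇ df - (df ⊗ df) / (2 f)) / (2 f)`. -/
def tT (G : E → E →L[ℝ] E →L[ℝ] ℝ) (f : E → ℝ) (u X Y : E) : ℝ :=
  -(1 / (2 * f u)) * (hess G f u X Y - 1 / (2 * f u) * (fderiv ℝ f u X * fderiv ℝ f u Y))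

/-- The covariant derivative `(∇_D T)(X, Y)`. -/
def nablaT (G : E → E →L[ℝ] E →L[ℝ] ℝ) (f : E → ℝ) (u D X Y : E) : ℝ :=
  fderiv ℝ (fun v => tT G f v X Y) u D - tT G f u (Gam G u D X) Y - tT G f u X (Gam G u D Y)

/-- `tr T = g^{ab} T_{ab}`. -/
def trT [FiniteDimensional ℝ E] (G : E → E →L[ℝ] E →L[ℝ] ℝ) (f : E → ℝ) (u : E) : ℝ :=
  contract G u (tT G f u)

/-- `P = g^{ab} f_a f_b / (4 f²)`. -/
def sP (G : E → E →L[ℝ] E →L[ℝ] ℝ) (f : E → ℝ) (u : E) : ℝ :=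
  1 / (4 * f u ^ 2) * fderiv ℝ f u (grad G f u)

end Coord

/-! ## Tensors on manifolds -/

/-- A field of bilinear forms on the tangent spaces. -/
abbrev BilinField {E H : Type*} [NormedAddCommGroup E] [NormedSpace ℝ E] [TopologicalSpace H]
    (I : ModelWithCorners ℝ E H) (M : Type*) [TopologicalSpace M] [ChartedSpace H M] :=
  ∀ x : M, TangentSpace I x →L[ℝ] TangentSpace I x →L[ℝ] ℝ

/-- A field of covectors. -/
abbrev CovField {E H : Type*} [NormedAddCommGroup E] [NormedSpace ℝ E] [TopologicalSpace H]
    (I : ModelWithCorners ℝ E H) (M : Type*) [TopologicalSpace M] [ChartedSpace H M] :=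
  ∀ x : M, TangentSpace I x →L[ℝ] ℝ

section Manifold

variable {E H : Type*} [NormedAddCommGroup E] [NormedSpace ℝ E] [FiniteDimensional ℝ E]
  [TopologicalSpace H]
  {I : ModelWithCorners ℝ E H} {M : Type*} [TopologicalSpace M] [ChartedSpace H M]

/-- Smooth semi-Riemannian metrics. -/
structure IsSemiRiemannianMetric [IsManifold I ∞ M] (g : BilinField I M) : Prop where
  symm : ∀ (x : M) (v w : TangentSpace I x), g x v w = g x w v
  nondegenerate : ∀ (x : M) (v : TangentSpace I x), (∀ w, g x v w = 0) → v = 0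
  contMDiff : ContMDiff I (I.prod 𝓘(ℝ, E →L[ℝ] E →L[ℝ] ℝ)) ∞
    (fun x => TotalSpace.mk' (E →L[ℝ] E →L[ℝ] ℝ)
      (E := fun x : M => TangentSpace I x →L[ℝ] TangentSpace I x →L[ℝ] ℝ) x (g x))

/-- Smooth 1-forms. -/
def IsSmoothOneForm [IsManifold I ∞ M] (om : CovField I M) : Prop :=
  ContMDiff I (I.prod 𝓘(ℝ, E →L[ℝ] ℝ)) ∞
    (fun x => TotalSpace.mk' (E →L[ℝ] ℝ) (E := fun x : M => TangentSpace I x →L[ℝ] ℝ) x (om x))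

/-- A bilinear form on a tangent space, viewed on the model space `E` to which the tangent space
is definitionally equal. -/
def formAt (g : BilinField I M) (x : M) : E →L[ℝ] E →L[ℝ] ℝ := g x

/-- The derivative at `u` of the inverse of the preferred chart at `x₀`. -/
def chartSymmDeriv (I : ModelWithCorners ℝ E H) (x₀ : M) (u : E) : E →L[ℝ] E :=
  mfderiv 𝓘(ℝ, E) I (extChartAt I x₀).symm u

/-- The components of `g` in the preferred chart `φ` at `x₀`: the pullback of `g` under `φ⁻¹`. -/
def chartMetric (g : BilinField I M) (x₀ : M) (u : E) : E →L[ℝ] E →L[ℝ] ℝ :=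
  (formAt g ((extChartAt I x₀).symm u)).bilinearComp
    (chartSymmDeriv I x₀ u) (chartSymmDeriv I x₀ u)

/-- A function read in the preferred chart at `x₀`. -/
def chartFun (I : ModelWithCorners ℝ E H) (f : M → ℝ) (x₀ : M) (u : E) : ℝ :=
  f ((extChartAt I x₀).symm u)

/-! The tangent space at `x` is identified with `E` through the preferred chart at `x`, so the
values at `x` of the tensors below are their components in that chart, at the image of `x`. -/

/-- The curvature tensor at `x`. -/
def riemannTensor (g : BilinField I M) (x : M) (X Y Z W : TangentSpace I x) : ℝ :=
  Coord.riem (chartMetric g x) (extChartAt I x x) X Y Z W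

/-- The Ricci tensor at `x`. -/
def ricciTensor (g : BilinField I M) (x : M) (X Y : TangentSpace I x) : ℝ :=
  Coord.ric (chartMetric g x) (extChartAt I x x) X Y

/-- `(∇_D R)(X, Y, Z, W)` at `x`. -/
def nablaRiemann (g : BilinField I M) (x : M) (D X Y Z W : TangentSpace I x) : ℝ :=
  Coord.nablaRiem (chartMetric g x) (extChartAt I x x) D X Y Z W

/-- The metric as an uncurried bilinear function. -/
def metricTensor (g : BilinField I M) (x : M) (X Y : TangentSpace I x) : ℝ := g x X Y

/-- The Kulkarni–Nomizu product
`(A ∧ B)_{ijkl} = A_{il} B_{jk} + A_{jk} B_{il} - A_{ik} B_{jl} - A_{jl} B_{ik}`. -/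
def kn {V : Type*} (A B : V → V → ℝ) (X Y Z W : V) : ℝ :=
  A X W * B Y Z + A Y Z * B X W - A X Z * B Y W - A Y W * B X Z

/-- The equation `∇R = Π ⊗ R + Φ ⊗ (S ∧ S)` at the point `x`. -/
def WGKEquationAt (g : BilinField I M) (Pi Phi : CovField I M) (x : M) : Prop :=
  ∀ D X Y Z W : TangentSpace I x,
    nablaRiemann g x D X Y Z W = Pi x D * riemannTensor g x X Y Z W
      + Phi x D * kn (ricciTensor g x) (ricciTensor g x) X Y Z W

/-- The set of points at which `∇R ≠ ξ ⊗ R` for every smooth 1-form `ξ`. -/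
def nonRecurrentSet [IsManifold I ∞ M] (g : BilinField I M) : Set M :=
  {x | ∀ ξ : CovField I M, IsSmoothOneForm ξ →
    ¬ ∀ D X Y Z W : TangentSpace I x,
      nablaRiemann g x D X Y Z W = ξ x D * riemannTensor g x X Y Z W}

/-- Weakly generalized recurrent with associated 1-forms `(Π, Φ)`. -/
def IsWGK [IsManifold I ∞ M] (g : BilinField I M) (Pi Phi : CovField I M) : Prop :=
  IsSmoothOneForm Pi ∧ IsSmoothOneForm Phi ∧
    ∀ x ∈ nonRecurrentSet g, WGKEquationAt g Pi Phi x

/-! Quantities on the base attached to the metric `g` and the warping function `f`. -/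

/-- The differential `df` at `x`. -/
def dFun (I : ModelWithCorners ℝ E H) (f : M → ℝ) (x : M) (X : TangentSpace I x) : ℝ :=
  mfderiv I 𝓘(ℝ, ℝ) f x X

/-- The gradient of `f` at `x`. -/
def gradFun (g : BilinField I M) (f : M → ℝ) (x : M) : TangentSpace I x :=
  Coord.grad (E := E) (chartMetric g x) (chartFun I f x) (extChartAt I x x)

/-- The tensor `T` at `x`. -/
def tensorT (g : BilinField I M) (f : M → ℝ) (x : M) (X Y : TangentSpace I x) : ℝ :=
  Coord.tT (chartMetric g x) (chartFun I f x) (extChartAt I x x) X Y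

/-- `(∇_D T)(X, Y)` at `x`. -/
def nablaTensorT (g : BilinField I M) (f : M → ℝ) (x : M) (D X Y : TangentSpace I x) : ℝ :=
  Coord.nablaT (chartMetric g x) (chartFun I f x) (extChartAt I x x) D X Y

/-- The function `P`. -/
def scalarP (g : BilinField I M) (f : M → ℝ) (x : M) : ℝ :=
  Coord.sP (chartMetric g x) (chartFun I f x) (extChartAt I x x)

/-- The differential `dP` at `x`, computed like `∇R` and `∇T` from the expression of `P` in the
preferred chart at `x`. -/
def dScalarP (g : BilinField I M) (f : M → ℝ) (x : M) (X : TangentSpace I x) : ℝ :=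
  Coord.dF (Coord.sP (chartMetric g x) (chartFun I f x)) (extChartAt I x x) X

/-- `Q = f ((k - 1) P - tr T)`, where `k` is the dimension of the fiber. -/
def scalarQ (k : ℝ) (g : BilinField I M) (f : M → ℝ) (x : M) : ℝ :=
  f x * ((k - 1) * scalarP g f x
    - Coord.trT (chartMetric g x) (chartFun I f x) (extChartAt I x x))

end Manifold

/-! ## Warped products -/

section Warped

variable {E H : Type*} [NormedAddCommGroup E] [NormedSpace ℝ E] [FiniteDimensional ℝ E]
  [TopologicalSpace H]
  {I : ModelWithCorners ℝ E H} {M : Type*} [TopologicalSpace M] [ChartedSpace H M]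
  {F H' : Type*} [NormedAddCommGroup F] [NormedSpace ℝ F] [FiniteDimensional ℝ F]
  [TopologicalSpace H']
  {J : ModelWithCorners ℝ F H'} {N : Type*} [TopologicalSpace N] [ChartedSpace H' N]

/-- The derivative of the projection onto the base. -/
def projBase (I : ModelWithCorners ℝ E H) (J : ModelWithCorners ℝ F H') (q : M × N) :
    E × F →L[ℝ] E :=
  mfderiv (I.prod J) I (Prod.fst : M × N → M) q

/-- The derivative of the projection onto the fiber. -/
def projFiber (I : ModelWithCorners ℝ E H) (J : ModelWithCorners ℝ F H') (q : M × N) :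
    E × F →L[ℝ] F :=
  mfderiv (I.prod J) J (Prod.snd : M × N → N) q

/-- The bilinear form `π^* gB + (f ∘ π) σ^* gF` on `E × F`, the tangent space of `M × N`. -/
def warpedForm (gB : BilinField I M) (gF : BilinField J N) (f : M → ℝ) (q : M × N) :
    E × F →L[ℝ] E × F →L[ℝ] ℝ :=
  (formAt gB q.1).bilinearComp (projBase I J q) (projBase I J q)
    + f q.1 • (formAt gF q.2).bilinearComp (projFiber I J q) (projFiber I J q)

/-- The warped product metric on `M × N`. -/
def warpedMetric (gB : BilinField I M) (gF : BilinField J N) (f : M → ℝ) :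
    BilinField (I.prod J) (M × N) := fun q => warpedForm gB gF f q

/-- The base component of a 1-form on `M × N` at `q`. -/
def baseForm (om : CovField (I.prod J) (M × N)) (q : M × N) (X : TangentSpace I q.1) : ℝ :=
  (om q : (E × F) →L[ℝ] ℝ) ((X : E), (0 : F))

/-- The fiber component of a 1-form on `M × N` at `q`. -/
def fiberForm (om : CovField (I.prod J) (M × N)) (q : M × N) (V : TangentSpace J q.2) : ℝ :=
  (om q : (E × F) →L[ℝ] ℝ) ((0 : E), (V : F))

/-- The simultaneous identities at the point `q` of the warped product, with `k` the dimension
of the fiber, `R`, `S` the curvature and Ricci tensors of the base, `R'`, `S'` those of the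
fiber. Tensor products are evaluated on arbitrary tangent vectors. -/
structure WarpedWGKConditionsAt (gB : BilinField I M) (gF : BilinField J N) (f : M → ℝ)
    (Pi Phi : CovField (I.prod J) (M × N)) (q : M × N) : Prop where
  base_horizontal : ∀ D X Y Z W : TangentSpace I q.1,
    let k : ℝ := Module.finrank ℝ F;
    let S := ricciTensor gB q.1;
    let T := tensorT gB f q.1;
    nablaRiemann gB q.1 D X Y Z W
      = baseForm Pi q D * riemannTensor gB q.1 X Y Z W
        + baseForm Phi q D * kn S S X Y Z W
        - 2 * k * baseForm Phi q D * kn S T X Y Z W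
        + k ^ 2 * baseForm Phi q D * kn T T X Y Z W
  base_vertical : ∀ (D : TangentSpace J q.2) (X Y Z W : TangentSpace I q.1),
    let k : ℝ := Module.finrank ℝ F;
    let S := ricciTensor gB q.1;
    let T := tensorT gB f q.1;
    -(fiberForm Pi q D * riemannTensor gB q.1 X Y Z W)
      = fiberForm Phi q D * kn S S X Y Z W
        - 2 * k * fiberForm Phi q D * kn S T X Y Z W
        + k ^ 2 * fiberForm Phi q D * kn T T X Y Z W
  fiber_horizontal : ∀ (D : TangentSpace I q.1) (X Y Z W : TangentSpace J q.2),
    let k : ℝ := Module.finrank ℝ F;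
    let S' := ricciTensor gF q.2;
    let g' := metricTensor gF q.2;
    let P := scalarP gB f q.1;
    let Q := scalarQ k gB f q.1;
    -(dFun I f q.1 D + f q.1 * baseForm Pi q D) * riemannTensor gF q.2 X Y Z W
      = baseForm Phi q D * kn S' S' X Y Z W
        + 2 * Q * baseForm Phi q D * kn g' S' X Y Z W
        + (1 / 2 * f q.1 ^ 2 * (P * baseForm Pi q D - dScalarP gB f q.1 D)
            + Q ^ 2 * baseForm Phi q D) * kn g' g' X Y Z W
  fiber_vertical : ∀ D X Y Z W : TangentSpace J q.2,
    let k : ℝ := Module.finrank ℝ F;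
    let S' := ricciTensor gF q.2;
    let g' := metricTensor gF q.2;
    let P := scalarP gB f q.1;
    let Q := scalarQ k gB f q.1;
    f q.1 * nablaRiemann gF q.2 D X Y Z W
      = f q.1 * fiberForm Pi q D * riemannTensor gF q.2 X Y Z W
        + fiberForm Phi q D * kn S' S' X Y Z W
        + 2 * Q * fiberForm Phi q D * kn g' S' X Y Z W
        + (1 / 2 * f q.1 ^ 2 * P * fiberForm Pi q D
            + Q ^ 2 * fiberForm Phi q D) * kn g' g' X Y Z W
  mixed_horizontal : ∀ (D X Y : TangentSpace I q.1) (V U : TangentSpace J q.2),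
    let k : ℝ := Module.finrank ℝ F;
    let S := ricciTensor gB q.1;
    let T := tensorT gB f q.1;
    let Q := scalarQ k gB f q.1;
    2 * baseForm Phi q D * (S X Y - k * T X Y) * ricciTensor gF q.2 V U
      = -(f q.1 * (nablaTensorT gB f q.1 D X Y - baseForm Pi q D * T X Y)
          + 2 * Q * baseForm Phi q D * (S X Y - k * T X Y)) * metricTensor gF q.2 V U
  mixed_vertical : ∀ (D : TangentSpace J q.2) (X Y : TangentSpace I q.1)
      (V U : TangentSpace J q.2),
    let k : ℝ := Module.finrank ℝ F;
    let S := ricciTensor gB q.1;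
    let T := tensorT gB f q.1;
    let Q := scalarQ k gB f q.1;
    2 * fiberForm Phi q D * (S X Y - k * T X Y) * ricciTensor gF q.2 V U
      = -(-(f q.1 * fiberForm Pi q D * T X Y)
          + 2 * Q * fiberForm Phi q D * (S X Y - k * T X Y)) * metricTensor gF q.2 V U
  grad_curvature : ∀ X Y Z : TangentSpace I q.1,
    let T := tensorT gB f q.1;
    riemannTensor gB q.1 X Y Z (gradFun gB f q.1)
      = -(dFun I f q.1 X * T Y Z - dFun I f q.1 Y * T X Z)
  fiber_curvature : ∀ (D : TangentSpace I q.1) (X Y Z W : TangentSpace J q.2),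
    let g' := metricTensor gF q.2;
    dFun I f q.1 D * riemannTensor gF q.2 X Y Z W
      = f q.1 ^ 2 * dScalarP gB f q.1 D * (1 / 2 * kn g' g' X Y Z W)

end Warped

end WarpedProduct

end

/-! At a point both sides of the equation are multilinear in five tangent vectors, and the tangent
space of the product splits into horizontal and vertical parts. The equation therefore holds at the
point exactly when it holds on all tuples of purely horizontal or vertical vectors; the eight
identities are its inequivalent components.

The work is to express `R`, `S` and `∇R` of the warped metric through base, fiber and `f`. The
Christoffel symbols (`GamL_warp`) lead to `riem_warp`, whose trace gives `ric_warp` and whose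
covariant derivative gives `nablaRiem_warp`. Now `R` and `S ∧ S` are block tensors: they vanish when
exactly one or exactly three arguments are vertical. `∇R` has further components of these types when
the direction of differentiation is vertical, and these are multiples of `gradDefect` and
`fiberDefect`. Their vanishing is (4)(i) and (4)(ii); the remaining components are (1), (2), (3),
each once for a horizontal and once for a vertical direction. `equation_iff` carries this out in
coordinates.

The passage to manifolds uses that in the product chart the metric agrees, near the point, with the
coordinate warped product of the two chart metrics, and that all tensors involved depend only on the
germ of the metric. -/

noncomputable section

set_option maxSynthPendingDepth 3

namespace WarpedProduct

/-! ### Levi-Civita connection and curvature symmetries in coordinates -/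

namespace Coord

variable {E : Type*} [NormedAddCommGroup E] [NormedSpace ℝ E]

/-- A smooth semi-Riemannian metric on an open set of coordinates. -/
structure LocalMetric (G : E → E →L[ℝ] E →L[ℝ] ℝ) (U : Set E) : Prop where
  isOpen : IsOpen U
  contDiffOn : ContDiffOn ℝ ∞ G U
  symm : ∀ u ∈ U, ∀ v w, G u v w = G u w v
  nondegenerate : ∀ u ∈ U, ∀ v, (∀ w, G u v w = 0) → v = 0

/-- Christoffel symbols of the first kind as a trilinear map. -/
def koszulL (G : E → E →L[ℝ] E →L[ℝ] ℝ) (u : E) : E →L[ℝ] E →L[ℝ] E →L[ℝ] ℝ :=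
  (1 / 2 : ℝ) • (fderiv ℝ G u + (fderiv ℝ G u).flip
    - ((ContinuousLinearMap.flipₗᵢ ℝ E E ℝ).toContinuousLinearEquiv :
        (E →L[ℝ] E →L[ℝ] ℝ) →L[ℝ] E →L[ℝ] E →L[ℝ] ℝ).comp (fderiv ℝ G u).flip)

/-- Christoffel symbols of the second kind as a bilinear map. -/
def GamL (G : E → E →L[ℝ] E →L[ℝ] ℝ) (u : E) : E →L[ℝ] E →L[ℝ] E :=
  (ContinuousLinearMap.compL ℝ E (E →L[ℝ] ℝ) E (G u).inverse).comp (koszulL G u)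

lemma koszulL_apply (G : E → E →L[ℝ] E →L[ℝ] ℝ) (u X Y Z : E) :
    koszulL G u X Y Z = 1 / 2 * (fderiv ℝ G u X Y Z + fderiv ℝ G u Y X Z - fderiv ℝ G u Z X Y) := by
  simp [koszulL]

lemma GamL_apply (G : E → E →L[ℝ] E →L[ℝ] ℝ) (u X Y : E) :
    GamL G u X Y = sharp G u (koszulL G u X Y) := rfl

namespace LocalMetric

variable {G : E → E →L[ℝ] E →L[ℝ] ℝ} {U : Set E} {u : E}

lemma mem_nhds (h : LocalMetric G U) (hu : u ∈ U) : U ∈ nhds u := h.isOpen.mem_nhds hu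

lemma contDiffAt (h : LocalMetric G U) (hu : u ∈ U) : ContDiffAt ℝ ∞ G u :=
  h.contDiffOn.contDiffAt (h.mem_nhds hu)

lemma differentiableAt (h : LocalMetric G U) (hu : u ∈ U) : DifferentiableAt ℝ G u :=
  (h.contDiffAt hu).differentiableAt (by simp)

lemma isInvertible [FiniteDimensional ℝ E] (h : LocalMetric G U) (hu : u ∈ U) :
    (G u).IsInvertible := by
  have hinj : Function.Injective (G u : E →ₗ[ℝ] E →L[ℝ] ℝ) := by
    rw [← LinearMap.ker_eq_bot, LinearMap.ker_eq_bot']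
    intro v hv
    refine h.nondegenerate u hu v fun w => ?_
    have : G u v = 0 := hv
    simp [this]
  have hdim : Module.finrank ℝ E = Module.finrank ℝ (E →L[ℝ] ℝ) := by
    rw [← (LinearMap.toContinuousLinearMap : (E →ₗ[ℝ] ℝ) ≃ₗ[ℝ] E →L[ℝ] ℝ).finrank_eq]
    exact (Subspace.dual_finrank_eq (K := ℝ) (V := E)).symm
  let e := LinearEquiv.ofInjectiveOfFinrankEq (G u : E →ₗ[ℝ] E →L[ℝ] ℝ) hinj hdim
  exact ⟨e.toContinuousLinearEquiv, by ext; rfl⟩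

lemma apply_sharp [FiniteDimensional ℝ E] (h : LocalMetric G U) (hu : u ∈ U) (α : E →L[ℝ] ℝ) :
    G u (sharp G u α) = α :=
  (((h.isInvertible hu).inverse_apply_eq).1 rfl).symm

lemma sharp_eq [FiniteDimensional ℝ E] (h : LocalMetric G U) (hu : u ∈ U) {α : E →L[ℝ] ℝ} {v : E}
    (hv : ∀ w, G u v w = α w) : sharp G u α = v :=
  (h.isInvertible hu).inverse_apply_eq.2 (ContinuousLinearMap.ext fun w => (hv w).symm)

lemma eq_of_forall (h : LocalMetric G U) (hu : u ∈ U) {v v' : E}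
    (hv : ∀ w, G u v w = G u v' w) : v = v' := by
  refine sub_eq_zero.1 (h.nondegenerate u hu _ fun w => ?_)
  simp [hv]

lemma fderiv_apply (h : LocalMetric G U) (hu : u ∈ U) (Y D : E) :
    fderiv ℝ (fun v => G v Y) u D = fderiv ℝ G u D Y := by
  rw [((h.differentiableAt hu).hasFDerivAt.clm_apply (hasFDerivAt_const Y u)).fderiv]
  simp

lemma fderiv_apply₂ (h : LocalMetric G U) (hu : u ∈ U) (Y Z D : E) :
    fderiv ℝ (fun v => G v Y Z) u D = fderiv ℝ G u D Y Z := by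
  rw [(((h.differentiableAt hu).hasFDerivAt.clm_apply (hasFDerivAt_const Y u)).clm_apply
    (hasFDerivAt_const Z u)).fderiv]
  simp

lemma fderiv_symm (h : LocalMetric G U) (hu : u ∈ U) (D Y Z : E) :
    fderiv ℝ G u D Y Z = fderiv ℝ G u D Z Y := by
  rw [← h.fderiv_apply₂ hu, ← h.fderiv_apply₂ hu]
  congr 1
  refine Filter.EventuallyEq.fderiv_eq ?_
  filter_upwards [h.mem_nhds hu] with v hv using h.symm v hv _ _

lemma koszul_eq (h : LocalMetric G U) (hu : u ∈ U) (X Y : E) :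
    koszul G u X Y = koszulL G u X Y := by
  ext Z
  simp [koszulL_apply, koszul, h.fderiv_apply hu, h.fderiv_apply₂ hu]

/-- `Gam` differentiates the metric after evaluation on vectors, `GamL` differentiates the metric
itself. They agree where the metric is differentiable, and `GamL` is multilinear by construction. -/
lemma Gam_eq (h : LocalMetric G U) (hu : u ∈ U) (X Y : E) : Gam G u X Y = GamL G u X Y := by
  rw [Gam, h.koszul_eq hu, GamL_apply]

lemma contDiffAt_koszulL (h : LocalMetric G U) (hu : u ∈ U) :
    ContDiffAt ℝ ∞ (koszulL G) u := by
  have h1 : ContDiffAt ℝ ∞ (fderiv ℝ G) u := (h.contDiffAt hu).fderiv_right (by simp)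
  have h2 : ContDiffAt ℝ ∞ (fun v => (fderiv ℝ G v).flip) u :=
    (ContinuousLinearMap.flipₗᵢ ℝ E E (E →L[ℝ] ℝ)).contDiff.contDiffAt.comp u h1
  exact ((h1.add h2).sub (contDiffAt_const.clm_comp h2)).const_smul (1 / 2 : ℝ)

section

variable [FiniteDimensional ℝ E]

lemma contDiffAt_inverse (h : LocalMetric G U) (hu : u ∈ U) :
    ContDiffAt ℝ ∞ (fun v => (G v).inverse) u := by
  have := FiniteDimensional.complete ℝ E
  exact (h.isInvertible hu).contDiffAt_map_inverse.comp u (h.contDiffAt hu)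

lemma contDiffAt_GamL (h : LocalMetric G U) (hu : u ∈ U) : ContDiffAt ℝ ∞ (GamL G) u :=
  ((ContinuousLinearMap.compL ℝ E (E →L[ℝ] ℝ) E).contDiff.contDiffAt.comp u
    (h.contDiffAt_inverse hu)).clm_comp (h.contDiffAt_koszulL hu)

lemma differentiableAt_GamL (h : LocalMetric G U) (hu : u ∈ U) :
    DifferentiableAt ℝ (GamL G) u := (h.contDiffAt_GamL hu).differentiableAt (by simp)

lemma apply_GamL (h : LocalMetric G U) (hu : u ∈ U) (X Y Z : E) :
    G u (GamL G u X Y) Z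
      = 1 / 2 * (fderiv ℝ G u X Y Z + fderiv ℝ G u Y X Z - fderiv ℝ G u Z X Y) := by
  rw [GamL_apply, h.apply_sharp hu, koszulL_apply]

lemma GamL_symm (h : LocalMetric G U) (hu : u ∈ U) (X Y : E) : GamL G u X Y = GamL G u Y X := by
  refine h.eq_of_forall hu fun Z => ?_
  rw [h.apply_GamL hu, h.apply_GamL hu, h.fderiv_symm hu Z]
  ring

/-- Metric compatibility `∇G = 0`. It eliminates derivatives of the metric in favour of Christoffel
symbols in the later computations. -/
lemma fderiv_eq (h : LocalMetric G U) (hu : u ∈ U) (X Y Z : E) :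
    fderiv ℝ G u X Y Z = G u (GamL G u X Y) Z + G u (GamL G u X Z) Y := by
  rw [h.apply_GamL hu, h.apply_GamL hu, h.fderiv_symm hu X Z Y]
  ring

lemma fderiv_Gam (h : LocalMetric G U) (hu : u ∈ U) (X Y Z : E) :
    fderiv ℝ (fun v => Gam G v Y Z) u X = fderiv ℝ (GamL G) u X Y Z := by
  have : (fun v => Gam G v Y Z) =ᶠ[nhds u] fun v => GamL G v Y Z := by
    filter_upwards [h.mem_nhds hu] with v hv using h.Gam_eq hv Y Z
  rw [this.fderiv_eq, (((h.differentiableAt_GamL hu).hasFDerivAt.clm_apply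
    (hasFDerivAt_const Y u)).clm_apply (hasFDerivAt_const Z u)).fderiv]
  simp

lemma fderiv_GamL_symm (h : LocalMetric G U) (hu : u ∈ U) (X Y Z : E) :
    fderiv ℝ (GamL G) u X Y Z = fderiv ℝ (GamL G) u X Z Y := by
  rw [← h.fderiv_Gam hu, ← h.fderiv_Gam hu]
  congr 1
  refine Filter.EventuallyEq.fderiv_eq ?_
  filter_upwards [h.mem_nhds hu] with v hv
  rw [h.Gam_eq hv, h.Gam_eq hv, h.GamL_symm hv]

lemma curv_eq (h : LocalMetric G U) (hu : u ∈ U) (X Y Z : E) :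
    curv G u X Y Z = fderiv ℝ (GamL G) u X Y Z - fderiv ℝ (GamL G) u Y X Z
      + GamL G u X (GamL G u Y Z) - GamL G u Y (GamL G u X Z) := by
  simp only [curv, h.fderiv_Gam hu, h.Gam_eq hu]

lemma riem_eq (h : LocalMetric G U) (hu : u ∈ U) (X Y Z W : E) :
    riem G u X Y Z W = G u (fderiv ℝ (GamL G) u X Y W - fderiv ℝ (GamL G) u Y X W
      + GamL G u X (GamL G u Y W) - GamL G u Y (GamL G u X W)) Z := by
  rw [riem, h.curv_eq hu]

lemma differentiableAt_riem (h : LocalMetric G U) (hu : u ∈ U) (X Y Z W : E) :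
    DifferentiableAt ℝ (fun v => riem G v X Y Z W) u := by
  have : (fun v => riem G v X Y Z W) =ᶠ[nhds u] fun v =>
      G v (fderiv ℝ (GamL G) v X Y W - fderiv ℝ (GamL G) v Y X W
      + GamL G v X (GamL G v Y W) - GamL G v Y (GamL G v X W)) Z := by
    filter_upwards [h.mem_nhds hu] with v hv using h.riem_eq hv X Y Z W
  refine DifferentiableAt.congr_of_eventuallyEq ?_ this
  have h1 := h.differentiableAt hu
  have h2 := h.differentiableAt_GamL hu
  have h3 : DifferentiableAt ℝ (fderiv ℝ (GamL G)) u :=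
    ((h.contDiffAt_GamL hu).fderiv_right (m := ∞) (by simp)).differentiableAt (by simp)
  fun_prop

lemma riem_swap (h : LocalMetric G U) (hu : u ∈ U) (X Y Z W : E) :
    riem G u Y X Z W = - riem G u X Y Z W := by
  rw [h.riem_eq hu, h.riem_eq hu, ← neg_apply, ← map_neg]
  congr 2
  abel

/-- First Bianchi identity, from the symmetry of the Christoffel symbols and of their derivatives.
The curvature operator acts on the last slot, so the cyclic sum runs over slots 1, 2, 4. -/
lemma riem_bianchi (h : LocalMetric G U) (hu : u ∈ U) (X Y Z W : E) :
    riem G u X Y W Z + riem G u Y Z W X + riem G u Z X W Y = 0 := by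
  simp only [h.riem_eq hu, map_add, map_sub, add_apply,
    sub_apply]
  rw [h.fderiv_GamL_symm hu X Z Y, h.fderiv_GamL_symm hu Y Z X, h.fderiv_GamL_symm hu Z Y X,
    h.GamL_symm hu Z Y, h.GamL_symm hu Z X, h.GamL_symm hu Y X]
  ring

lemma fderiv_fderiv_eq (h : LocalMetric G U) (hu : u ∈ U) (X Y Z W : E) :
    fderiv ℝ (fderiv ℝ G) u X Y Z W
      = fderiv ℝ G u X (GamL G u Y Z) W + G u (fderiv ℝ (GamL G) u X Y Z) W
        + (fderiv ℝ G u X (GamL G u Y W) Z + G u (fderiv ℝ (GamL G) u X Y W) Z) := by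
  have h3 : DifferentiableAt ℝ (fderiv ℝ G) u :=
    ((h.contDiffAt hu).fderiv_right (m := ∞) (by simp)).differentiableAt (by simp)
  have hl := ((h3.hasFDerivAt.clm_apply (hasFDerivAt_const Y u)).clm_apply
    (hasFDerivAt_const Z u)).clm_apply (hasFDerivAt_const W u)
  have hG := (h.differentiableAt hu).hasFDerivAt
  have hA := (h.differentiableAt_GamL hu).hasFDerivAt
  have hr (Z W : E) := (hG.clm_apply ((hA.clm_apply (hasFDerivAt_const Y u)).clm_apply
    (hasFDerivAt_const Z u))).clm_apply (hasFDerivAt_const W u)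
  have heq : (fun v => fderiv ℝ G v Y Z W) =ᶠ[nhds u] fun v =>
      G v (GamL G v Y Z) W + G v (GamL G v Y W) Z := by
    filter_upwards [h.mem_nhds hu] with v hv using h.fderiv_eq hv Y Z W
  have hh := congrArg (fun L => L X)
    ((hl.congr_of_eventuallyEq heq.symm).unique ((hr Z W).add (hr W Z)))
  simp at hh
  rw [hh]; ring

/-- Second derivatives of the metric commute; expanding both orders by `fderiv_fderiv_eq` makes the
difference exactly the sum of the two curvature terms. -/
lemma riem_skew (h : LocalMetric G U) (hu : u ∈ U) (X Y Z W : E) :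
    riem G u X Y W Z = - riem G u X Y Z W := by
  have hs : IsSymmSndFDerivAt ℝ G u :=
    (h.contDiffAt hu).isSymmSndFDerivAt (by simpa using ENat.LEInfty.out)
  have h0 := congrArg (fun L => L Z W) (hs X Y)
  simp only [h.fderiv_fderiv_eq hu, h.fderiv_eq hu] at h0
  simp only [h.riem_eq hu, map_add, map_sub, add_apply,
    sub_apply]
  rw [h.symm u hu (GamL G u X W) (GamL G u Y Z), h.symm u hu (GamL G u X Z) (GamL G u Y W)] at h0
  linear_combination h0

/-- The classical octahedron argument: four Bianchi identities combined with the two skew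
symmetries. -/
lemma riem_pair (h : LocalMetric G U) (hu : u ∈ U) (X Y Z W : E) :
    riem G u X Y Z W = riem G u Z W X Y := by
  have b1 := h.riem_bianchi hu X Y Z W
  have b2 := h.riem_bianchi hu Y Z W X
  have b3 := h.riem_bianchi hu Z W X Y
  have b4 := h.riem_bianchi hu W X Y Z
  have s := fun A B C D => h.riem_skew hu A B C D
  have t := fun A B C D => h.riem_swap hu A B C D
  linarith [s Y Z W X, s Z W X Y, s X W Z Y, s W Y Z X, s X Z W Y, s Y X Z W, t X Y Z W,
    t X Y W Z, t Z X W Y, t W X Y Z, t W X Z Y, t Y W Z X]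

end

end LocalMetric

end Coord

/-! ### Metric contraction, gradient, `T` and `P` -/

namespace Coord

variable {E : Type*} [NormedAddCommGroup E] [NormedSpace ℝ E]

/-- A function of two vectors that is bilinear. -/
def IsBilin (A : E → E → ℝ) : Prop := ∃ L : E →ₗ[ℝ] E →ₗ[ℝ] ℝ, ∀ X Y, A X Y = L X Y

lemma isBilin_of {A : E → E → ℝ} (h1 : ∀ X X' Y, A (X + X') Y = A X Y + A X' Y)
    (h2 : ∀ (c : ℝ) X Y, A (c • X) Y = c * A X Y)
    (h3 : ∀ X Y Y', A X (Y + Y') = A X Y + A X Y')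
    (h4 : ∀ (c : ℝ) X Y, A X (c • Y) = c * A X Y) : IsBilin A :=
  ⟨LinearMap.mk₂ ℝ A h1 h2 h3 h4, fun _ _ => rfl⟩

namespace LocalMetric

variable {G : E → E →L[ℝ] E →L[ℝ] ℝ} {U : Set E} {u : E} [FiniteDimensional ℝ E] {f : E → ℝ}

section contract

variable {ι : Type*} [Fintype ι]

lemma apply_sharp_symm (h : LocalMetric G U) (hu : u ∈ U) (α β : E →L[ℝ] ℝ) :
    α (sharp G u β) = β (sharp G u α) := by
  rw [← h.apply_sharp hu α, h.symm u hu, h.apply_sharp hu, h.apply_sharp hu]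

/-- Identifying the sum with the trace of an endomorphism shows that it does not depend on the
basis. This allows contractions on `E × F` to be computed in a product basis. -/
lemma sum_sharp_eq_trace (h : LocalMetric G U) (hu : u ∈ U) (L : E →ₗ[ℝ] E →ₗ[ℝ] ℝ)
    (b : Module.Basis ι ℝ E) :
    ∑ j, L (sharp G u (LinearMap.toContinuousLinearMap (b.coord j))) (b j)
      = LinearMap.trace ℝ E (((G u).inverse : (E →L[ℝ] ℝ) →ₗ[ℝ] E) ∘ₗ
          (LinearMap.toContinuousLinearMap : (E →ₗ[ℝ] ℝ) ≃ₗ[ℝ] E →L[ℝ] ℝ).toLinearMap ∘ₗ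
            L.flip) := by
  classical
  rw [LinearMap.trace_eq_matrix_trace ℝ b, Matrix.trace]
  refine Finset.sum_congr rfl fun j _ => ?_
  have := h.apply_sharp_symm hu (LinearMap.toContinuousLinearMap (b.coord j))
    (LinearMap.toContinuousLinearMap (L.flip (b j)))
  simpa [LinearMap.toMatrix_apply, sharp] using this.symm

lemma contract_eq_sum (h : LocalMetric G U) (hu : u ∈ U) {A : E → E → ℝ} (hA : IsBilin A)
    (b : Module.Basis ι ℝ E) :
    contract G u A = ∑ j, A (sharp G u (LinearMap.toContinuousLinearMap (b.coord j))) (b j) := by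
  obtain ⟨L, hL⟩ := hA
  simp only [hL, contract]
  rw [h.sum_sharp_eq_trace hu L b, ← h.sum_sharp_eq_trace hu L (Module.finBasis ℝ E),
    Finset.sum_comm]
  refine Finset.sum_congr rfl fun j _ => ?_
  conv_rhs => rw [← (Module.finBasis ℝ E).sum_repr (sharp G u _), map_sum, LinearMap.sum_apply]
  simp only [map_smul, LinearMap.smul_apply, smul_eq_mul]

lemma contract_metric (h : LocalMetric G U) (hu : u ∈ U) :
    contract G u (fun X Y => G u X Y) = Module.finrank ℝ E := by
  rw [h.contract_eq_sum hu (isBilin_of (by simp) (by simp) (by simp) (by simp))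
    (Module.finBasis ℝ E)]
  simp [h.apply_sharp hu]

lemma contract_mul (h : LocalMetric G U) (hu : u ∈ U) (V W : E) :
    contract G u (fun X Y => G u X V * G u Y W) = G u V W := by
  rw [h.contract_eq_sum hu (isBilin_of (by simp [add_mul]) (by simp [mul_assoc])
    (by simp [mul_add]) (by intros; simp; ring)) (Module.finBasis ℝ E)]
  simp only [h.apply_sharp hu]
  conv_rhs => rw [← (Module.finBasis ℝ E).sum_repr V, map_sum, sum_apply]
  simp

end contract

lemma contract_add (A B : E → E → ℝ) :
    contract G u (fun X Y => A X Y + B X Y) = contract G u A + contract G u B := by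
  simp [contract, mul_add, Finset.sum_add_distrib]

lemma contract_const_mul (c : ℝ) (A : E → E → ℝ) :
    contract G u (fun X Y => c * A X Y) = c * contract G u A := by
  simp [contract, Finset.mul_sum, mul_left_comm]

lemma isBilin_riem (h : LocalMetric G U) (hu : u ∈ U) (Y Z : E) :
    IsBilin fun X W => riem G u X Y Z W := by
  refine isBilin_of ?_ ?_ ?_ ?_ <;> intros <;> simp only [h.riem_eq hu] <;> simp <;> ring

section function

lemma apply_grad (h : LocalMetric G U) (hu : u ∈ U) (Y : E) :
    G u (grad G f u) Y = fderiv ℝ f u Y := by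
  rw [grad, h.apply_sharp hu]

lemma contDiffAt_grad (h : LocalMetric G U) (hu : u ∈ U) (hf : ContDiffOn ℝ ∞ f U) :
    ContDiffAt ℝ ∞ (grad G f) u :=
  (h.contDiffAt_inverse hu).clm_apply
    ((hf.contDiffAt (h.mem_nhds hu)).fderiv_right (by simp))

omit [FiniteDimensional ℝ E] in
lemma differentiableAt_fderiv (h : LocalMetric G U) (hu : u ∈ U) (hf : ContDiffOn ℝ ∞ f U) :
    DifferentiableAt ℝ (fderiv ℝ f) u :=
  ((hf.contDiffAt (h.mem_nhds hu)).fderiv_right (m := ∞) (by simp)).differentiableAt (by simp)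

omit [FiniteDimensional ℝ E] in
lemma differentiableAt_fun (h : LocalMetric G U) (hu : u ∈ U) (hf : ContDiffOn ℝ ∞ f U) :
    DifferentiableAt ℝ f u :=
  (hf.contDiffAt (h.mem_nhds hu)).differentiableAt (by simp)

lemma differentiableAt_grad (h : LocalMetric G U) (hu : u ∈ U) (hf : ContDiffOn ℝ ∞ f U) :
    DifferentiableAt ℝ (grad G f) u :=
  (h.contDiffAt_grad hu hf).differentiableAt (by simp)

omit [FiniteDimensional ℝ E] in
lemma fderiv_fderiv_apply (h : LocalMetric G U) (hu : u ∈ U) (hf : ContDiffOn ℝ ∞ f U) (X Y : E) :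
    fderiv ℝ (fun v => fderiv ℝ f v Y) u X = fderiv ℝ (fderiv ℝ f) u X Y := by
  rw [((h.differentiableAt_fderiv hu hf).hasFDerivAt.clm_apply (hasFDerivAt_const Y u)).fderiv]
  simp

omit [FiniteDimensional ℝ E] in
lemma fderiv_fderiv_symm (h : LocalMetric G U) (hu : u ∈ U) (hf : ContDiffOn ℝ ∞ f U) (X Y : E) :
    fderiv ℝ (fderiv ℝ f) u X Y = fderiv ℝ (fderiv ℝ f) u Y X :=
  (hf.contDiffAt (h.mem_nhds hu)).isSymmSndFDerivAt (by simpa using ENat.LEInfty.out) X Y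

omit [FiniteDimensional ℝ E] in
lemma hess_eq (h : LocalMetric G U) (hu : u ∈ U) (hf : ContDiffOn ℝ ∞ f U) (X Y : E) :
    hess G f u X Y = fderiv ℝ (fderiv ℝ f) u X Y - fderiv ℝ f u (GamL G u X Y) := by
  rw [hess, h.fderiv_fderiv_apply hu hf, h.Gam_eq hu]

lemma tT_symm (h : LocalMetric G U) (hu : u ∈ U) (hf : ContDiffOn ℝ ∞ f U) (X Y : E) :
    tT G f u X Y = tT G f u Y X := by
  rw [tT, tT, h.hess_eq hu hf, h.hess_eq hu hf, h.fderiv_fderiv_symm hu hf, h.GamL_symm hu]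
  ring

lemma differentiableAt_tT (h : LocalMetric G U) (hu : u ∈ U) (hf : ContDiffOn ℝ ∞ f U)
    (hf0 : f u ≠ 0) (X Y : E) : DifferentiableAt ℝ (fun v => tT G f v X Y) u := by
  have : (fun v => tT G f v X Y) =ᶠ[nhds u] fun v =>
      -(1 / (2 * f v)) * (fderiv ℝ (fderiv ℝ f) v X Y - fderiv ℝ f v (GamL G v X Y)
        - 1 / (2 * f v) * (fderiv ℝ f v X * fderiv ℝ f v Y)) := by
    filter_upwards [h.mem_nhds hu] with v hv
    rw [tT, h.hess_eq hv hf]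
  refine DifferentiableAt.congr_of_eventuallyEq ?_ this
  have h1 := h.differentiableAt_fderiv hu hf
  have h2 := h.differentiableAt_GamL hu
  have h3 : DifferentiableAt ℝ (fderiv ℝ (fderiv ℝ f)) u :=
    ((((hf.contDiffAt (h.mem_nhds hu)).fderiv_right (m := ∞) (by simp))).fderiv_right (m := ∞)
      (by simp)).differentiableAt (by simp)
  have h4 := h.differentiableAt_fun hu hf
  have h5 : 2 * f u ≠ 0 := by simp [hf0]
  fun_prop (disch := assumption)

/-- This says `g(∇_X grad f, Y) = Hess f(X, Y)`; it follows by differentiating `g(grad f, Y) =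
df(Y)`. -/
lemma apply_fderiv_grad (h : LocalMetric G U) (hu : u ∈ U) (hf : ContDiffOn ℝ ∞ f U) (X Y : E) :
    G u (fderiv ℝ (grad G f) u X) Y = hess G f u X Y - G u (GamL G u X (grad G f u)) Y := by
  have h1 := (((h.differentiableAt hu).hasFDerivAt.clm_apply
    (h.differentiableAt_grad hu hf).hasFDerivAt).clm_apply (hasFDerivAt_const Y u))
  have h2 := (h.differentiableAt_fderiv hu hf).hasFDerivAt.clm_apply (hasFDerivAt_const Y u)
  have heq : (fun v => fderiv ℝ f v Y) =ᶠ[nhds u] fun v => G v (grad G f v) Y := by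
    filter_upwards [h.mem_nhds hu] with v hv using (h.apply_grad hv Y).symm
  have hh := congrArg (fun L => L X) (h1.unique (h2.congr_of_eventuallyEq heq.symm))
  simp at hh
  rw [h.fderiv_eq hu, h.symm u hu (GamL G u X Y), h.apply_grad hu] at hh
  rw [h.hess_eq hu hf]
  linear_combination hh

lemma differentiableAt_sP (h : LocalMetric G U) (hu : u ∈ U) (hf : ContDiffOn ℝ ∞ f U)
    (hf0 : f u ≠ 0) : DifferentiableAt ℝ (sP G f) u := by
  unfold sP
  have h1 := h.differentiableAt_fderiv hu hf
  have h2 := h.differentiableAt_grad hu hf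
  have h4 := h.differentiableAt_fun hu hf
  have h5 : 4 * f u ^ 2 ≠ 0 := by simp [hf0]
  fun_prop (disch := assumption)

/-- Differentiating `df(grad f) = 4 f² P` gives `2 Hess f(X, grad f)` on the left, and the Hessian
is then rewritten through `T`. This is how `dP` enters `∇R`, which itself produces terms `T(X, grad
f)`. -/
lemma sq_mul_dF_sP (h : LocalMetric G U) (hu : u ∈ U) (hf : ContDiffOn ℝ ∞ f U)
    (hfpos : ∀ v ∈ U, f v ≠ 0) (X : E) :
    f u ^ 2 * dF (sP G f) u X
      = -(f u * tT G f u X (grad G f u)) - f u * fderiv ℝ f u X * sP G f u := by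
  have hf0 := hfpos u hu
  have h1 := ((h.differentiableAt_fderiv hu hf).hasFDerivAt.clm_apply
    (h.differentiableAt_grad hu hf).hasFDerivAt)
  have hfd := (h.differentiableAt_fun hu hf).hasFDerivAt
  have h2 := ((hfd.pow 2).const_mul 4).mul (h.differentiableAt_sP hu hf hf0).hasFDerivAt
  have heq : (fun v => fderiv ℝ f v (grad G f v)) =ᶠ[nhds u] fun v => 4 * f v ^ 2 * sP G f v := by
    filter_upwards [h.mem_nhds hu] with v hv
    have := hfpos v hv
    rw [sP]; field_simp
  have hh := congrArg (fun L => L X) (h2.unique (h1.congr_of_eventuallyEq heq.symm))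
  simp at hh
  have hg := h.apply_fderiv_grad hu hf X (grad G f u)
  rw [h.symm u hu, h.apply_grad hu, h.hess_eq hu hf, h.symm u hu, h.apply_grad hu] at hg
  rw [tT, h.hess_eq hu hf, dF]
  have hP : fderiv ℝ f u (grad G f u) = 4 * f u ^ 2 * sP G f u := heq.self_of_nhds
  rw [hg] at hh
  rw [hP]
  field_simp
  linear_combination hh

end function

end LocalMetric

end Coord

/-! ### Locality in the metric, and multilinearity -/

namespace Coord

section congr

variable {E : Type*} [NormedAddCommGroup E] [NormedSpace ℝ E]
  {G G' : E → E →L[ℝ] E →L[ℝ] ℝ} {u : E}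

lemma Gam_congr (h : G =ᶠ[nhds u] G') (X Y : E) : Gam G u X Y = Gam G' u X Y := by
  have h1 (Y : E) : (fun v => G v Y) =ᶠ[nhds u] fun v => G' v Y := h.mono fun v hv => by simp [hv]
  have h2 : (fun v => G v X Y) =ᶠ[nhds u] fun v => G' v X Y := h.mono fun v hv => by simp [hv]
  simp only [Gam, sharp, koszul, (h1 _).fderiv_eq, h2.fderiv_eq, h.self_of_nhds]

lemma Gam_eventuallyEq (h : G =ᶠ[nhds u] G') (X Y : E) :
    (fun v => Gam G v X Y) =ᶠ[nhds u] fun v => Gam G' v X Y :=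
  h.eventuallyEq_nhds.mono fun _ hv => Gam_congr hv X Y

/-- Dependence on the germ only is what is needed later: a chart metric of the product is a
coordinate warped product just near the point. -/
lemma riem_congr (h : G =ᶠ[nhds u] G') (X Y Z W : E) : riem G u X Y Z W = riem G' u X Y Z W := by
  simp only [riem, curv, (Gam_eventuallyEq h _ _).fderiv_eq, Gam_congr h, h.self_of_nhds]

lemma riem_eventuallyEq (h : G =ᶠ[nhds u] G') (X Y Z W : E) :
    (fun v => riem G v X Y Z W) =ᶠ[nhds u] fun v => riem G' v X Y Z W :=
  h.eventuallyEq_nhds.mono fun _ hv => riem_congr hv X Y Z W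

lemma nablaRiem_congr (h : G =ᶠ[nhds u] G') (D X Y Z W : E) :
    nablaRiem G u D X Y Z W = nablaRiem G' u D X Y Z W := by
  simp only [nablaRiem, (riem_eventuallyEq h _ _ _ _).fderiv_eq, riem_congr h, Gam_congr h]

lemma ric_congr [FiniteDimensional ℝ E] (h : G =ᶠ[nhds u] G') (X Y : E) :
    ric G u X Y = ric G' u X Y := by
  simp only [ric, contract, sharp, riem_congr h, h.self_of_nhds]

end congr

namespace LocalMetric

section multilinear

variable {E : Type*} [NormedAddCommGroup E] [NormedSpace ℝ E] [FiniteDimensional ℝ E]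
  {G : E → E →L[ℝ] E →L[ℝ] ℝ} {U : Set E} {u : E} {f : E → ℝ}

lemma riem_add₁ (h : LocalMetric G U) (hu : u ∈ U) (X X' Y Z W : E) :
    riem G u (X + X') Y Z W = riem G u X Y Z W + riem G u X' Y Z W := by
  simp [h.riem_eq hu]; ring

lemma riem_smul₁ (h : LocalMetric G U) (hu : u ∈ U) (c : ℝ) (X Y Z W : E) :
    riem G u (c • X) Y Z W = c * riem G u X Y Z W := by
  simp [h.riem_eq hu]; ring

lemma riem_sub₁ (h : LocalMetric G U) (hu : u ∈ U) (X X' Y Z W : E) :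
    riem G u (X - X') Y Z W = riem G u X Y Z W - riem G u X' Y Z W := by
  simp [h.riem_eq hu]; ring

lemma riem_add₂ (h : LocalMetric G U) (hu : u ∈ U) (X X' Y Z W : E) :
    riem G u Y (X + X') Z W = riem G u Y X Z W + riem G u Y X' Z W := by
  simp [h.riem_eq hu]; ring

lemma riem_smul₂ (h : LocalMetric G U) (hu : u ∈ U) (c : ℝ) (X Y Z W : E) :
    riem G u Y (c • X) Z W = c * riem G u Y X Z W := by
  simp [h.riem_eq hu]; ring

lemma riem_sub₂ (h : LocalMetric G U) (hu : u ∈ U) (X X' Y Z W : E) :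
    riem G u Y (X - X') Z W = riem G u Y X Z W - riem G u Y X' Z W := by
  simp [h.riem_eq hu]; ring

lemma riem_add₃ (h : LocalMetric G U) (hu : u ∈ U) (X X' Y Z W : E) :
    riem G u Y Z (X + X') W = riem G u Y Z X W + riem G u Y Z X' W := by
  simp [h.riem_eq hu]; ring

lemma riem_smul₃ (h : LocalMetric G U) (hu : u ∈ U) (c : ℝ) (X Y Z W : E) :
    riem G u Y Z (c • X) W = c * riem G u Y Z X W := by
  simp [h.riem_eq hu]

lemma riem_sub₃ (h : LocalMetric G U) (hu : u ∈ U) (X X' Y Z W : E) :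
    riem G u Y Z (X - X') W = riem G u Y Z X W - riem G u Y Z X' W := by
  simp [h.riem_eq hu]; ring

lemma riem_add₄ (h : LocalMetric G U) (hu : u ∈ U) (X X' Y Z W : E) :
    riem G u Y Z W (X + X') = riem G u Y Z W X + riem G u Y Z W X' := by
  simp [h.riem_eq hu]; ring

lemma riem_smul₄ (h : LocalMetric G U) (hu : u ∈ U) (c : ℝ) (X Y Z W : E) :
    riem G u Y Z W (c • X) = c * riem G u Y Z W X := by
  simp [h.riem_eq hu]; ring

lemma riem_sub₄ (h : LocalMetric G U) (hu : u ∈ U) (X X' Y Z W : E) :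
    riem G u Y Z W (X - X') = riem G u Y Z W X - riem G u Y Z W X' := by
  simp [h.riem_eq hu]; ring

omit [FiniteDimensional ℝ E] in
lemma tT_smul₁ (h : LocalMetric G U) (hu : u ∈ U) (hf : ContDiffOn ℝ ∞ f U) (c : ℝ) (X Y : E) :
    tT G f u (c • X) Y = c * tT G f u X Y := by
  simp [tT, h.hess_eq hu hf]; ring

omit [FiniteDimensional ℝ E] in
lemma tT_sub₁ (h : LocalMetric G U) (hu : u ∈ U) (hf : ContDiffOn ℝ ∞ f U) (X X' Y : E) :
    tT G f u (X - X') Y = tT G f u X Y - tT G f u X' Y := by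
  simp [tT, h.hess_eq hu hf]; ring

omit [FiniteDimensional ℝ E] in
lemma tT_smul₂ (h : LocalMetric G U) (hu : u ∈ U) (hf : ContDiffOn ℝ ∞ f U) (c : ℝ) (X Y : E) :
    tT G f u X (c • Y) = c * tT G f u X Y := by
  simp [tT, h.hess_eq hu hf]; ring

omit [FiniteDimensional ℝ E] in
lemma tT_sub₂ (h : LocalMetric G U) (hu : u ∈ U) (hf : ContDiffOn ℝ ∞ f U) (X Y Y' : E) :
    tT G f u X (Y - Y') = tT G f u X Y - tT G f u X Y' := by
  simp [tT, h.hess_eq hu hf]; ring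

end multilinear

end LocalMetric

/-! ### Warped metrics and their Christoffel symbols -/

section warp

variable {E F : Type*} [NormedAddCommGroup E] [NormedSpace ℝ E] [FiniteDimensional ℝ E]
  [NormedAddCommGroup F] [NormedSpace ℝ F] [FiniteDimensional ℝ F]

/-- The warped product of two metrics in coordinates. -/
def warp (gB : E → E →L[ℝ] E →L[ℝ] ℝ) (gF : F → F →L[ℝ] F →L[ℝ] ℝ) (f : E → ℝ) (u : E × F) :
    E × F →L[ℝ] E × F →L[ℝ] ℝ :=
  (gB u.1).bilinearComp (ContinuousLinearMap.fst ℝ E F) (ContinuousLinearMap.fst ℝ E F)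
    + f u.1 • (gF u.2).bilinearComp (ContinuousLinearMap.snd ℝ E F) (ContinuousLinearMap.snd ℝ E F)

omit [FiniteDimensional ℝ E] [FiniteDimensional ℝ F] in
lemma warp_apply (gB : E → E →L[ℝ] E →L[ℝ] ℝ) (gF : F → F →L[ℝ] F →L[ℝ] ℝ) (f : E → ℝ)
    (u a b : E × F) : warp gB gF f u a b = gB u.1 a.1 b.1 + f u.1 * gF u.2 a.2 b.2 := by
  simp [warp]

/-- Data of a warped product in coordinates. -/
structure WarpData (gB : E → E →L[ℝ] E →L[ℝ] ℝ) (gF : F → F →L[ℝ] F →L[ℝ] ℝ) (f : E → ℝ)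
    (UB : Set E) (UF : Set F) : Prop where
  base : LocalMetric gB UB
  fiber : LocalMetric gF UF
  smooth : ContDiffOn ℝ ∞ f UB
  ne_zero : ∀ x ∈ UB, f x ≠ 0

namespace WarpData

variable {gB : E → E →L[ℝ] E →L[ℝ] ℝ} {gF : F → F →L[ℝ] F →L[ℝ] ℝ} {f : E → ℝ}
  {UB : Set E} {UF : Set F} {x : E} {y : F}

lemma localMetric (h : WarpData gB gF f UB UF) : LocalMetric (warp gB gF f) (UB ×ˢ UF) where
  isOpen := h.base.isOpen.prod h.fiber.isOpen
  contDiffOn := by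
    rw [contDiffOn_clm_apply]
    intro a
    rw [contDiffOn_clm_apply]
    intro b
    simp only [warp_apply]
    have h1 : ContDiffOn ℝ ∞ (fun u : E × F => gB u.1) (UB ×ˢ UF) :=
      h.base.contDiffOn.comp contDiffOn_fst fun u hu => hu.1
    have h2 : ContDiffOn ℝ ∞ (fun u : E × F => gF u.2) (UB ×ˢ UF) :=
      h.fiber.contDiffOn.comp contDiffOn_snd fun u hu => hu.2
    have h3 : ContDiffOn ℝ ∞ (fun u : E × F => f u.1) (UB ×ˢ UF) :=
      h.smooth.comp contDiffOn_fst fun u hu => hu.1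
    exact ((h1.clm_apply contDiffOn_const).clm_apply contDiffOn_const).add
      (h3.mul ((h2.clm_apply contDiffOn_const).clm_apply contDiffOn_const))
  symm u hu a b := by
    rw [warp_apply, warp_apply, h.base.symm _ hu.1, h.fiber.symm _ hu.2]
  nondegenerate u hu a ha := by
    refine Prod.ext ?_ ?_
    · refine h.base.nondegenerate _ hu.1 _ fun w => ?_
      simpa [warp_apply] using ha (w, 0)
    · refine h.fiber.nondegenerate _ hu.2 _ fun w => ?_
      simpa [warp_apply, h.ne_zero _ hu.1] using ha (0, w)

lemma fderiv_warp (h : WarpData gB gF f UB UF) (hx : x ∈ UB) (hy : y ∈ UF) (a b c : E × F) :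
    fderiv ℝ (warp gB gF f) (x, y) a b c = fderiv ℝ gB x a.1 b.1 c.1
      + fderiv ℝ f x a.1 * gF y b.2 c.2 + f x * fderiv ℝ gF y a.2 b.2 c.2 := by
  have hu : (x, y) ∈ UB ×ˢ UF := ⟨hx, hy⟩
  rw [← h.localMetric.fderiv_apply₂ hu]
  simp only [warp_apply]
  have h1 : HasFDerivAt (fun u : E × F => gB u.1) _ (x, y) :=
    (h.base.differentiableAt hx).hasFDerivAt.comp (x, y) hasFDerivAt_fst
  have h2 : HasFDerivAt (fun u : E × F => gF u.2) _ (x, y) :=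
    (h.fiber.differentiableAt hy).hasFDerivAt.comp (x, y) hasFDerivAt_snd
  have h3 : HasFDerivAt (fun u : E × F => f u.1) _ (x, y) :=
    (h.base.differentiableAt_fun hx h.smooth).hasFDerivAt.comp (x, y) hasFDerivAt_fst
  have h4 := ((h1.clm_apply (hasFDerivAt_const b.1 _)).clm_apply (hasFDerivAt_const c.1 _)).add
    (h3.mul ((h2.clm_apply (hasFDerivAt_const b.2 _)).clm_apply (hasFDerivAt_const c.2 _)))
  refine (congrArg (fun L => L a) h4.fderiv).trans ?_
  simp
  ring

/-- By nondegeneracy it suffices to pair with a third vector and compare symbols of the first kind.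
The warping adds `-½ g̃(V, W) grad f` to the base part and `(df(X) W + df(Y) V) / (2f)` to the fiber
part. -/
lemma GamL_warp (h : WarpData gB gF f UB UF) (hx : x ∈ UB) (hy : y ∈ UF) (a b : E × F) :
    GamL (warp gB gF f) (x, y) a b
      = (GamL gB x a.1 b.1 - (1 / 2 * gF y a.2 b.2) • grad gB f x,
        GamL gF y a.2 b.2 + (1 / (2 * f x)) •
          (fderiv ℝ f x a.1 • b.2 + fderiv ℝ f x b.1 • a.2)) := by
  have hu : (x, y) ∈ UB ×ˢ UF := ⟨hx, hy⟩
  refine h.localMetric.eq_of_forall hu fun c => ?_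
  have hf := h.ne_zero x hx
  rw [h.localMetric.apply_GamL hu, h.fderiv_warp hx hy, h.fderiv_warp hx hy,
    h.fderiv_warp hx hy, warp_apply]
  simp only [map_sub, map_add, map_smul, sub_apply, add_apply, smul_apply, smul_eq_mul,
    h.base.apply_GamL hx, h.fiber.apply_GamL hy, h.base.apply_grad hx]
  rw [h.fiber.symm y hy b.2 c.2, h.fiber.symm y hy a.2 c.2, h.fiber.symm y hy c.2 a.2,
    h.fiber.symm y hy c.2 b.2]
  field_simp
  ring

end WarpData

end warp

end Coord

/-! ### Curvature, Ricci tensor and `∇R` of a warped product -/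

namespace Coord

namespace WarpData

variable {E F : Type*} [NormedAddCommGroup E] [NormedSpace ℝ E] [FiniteDimensional ℝ E]
  [NormedAddCommGroup F] [NormedSpace ℝ F] [FiniteDimensional ℝ F]
  {gB : E → E →L[ℝ] E →L[ℝ] ℝ} {gF : F → F →L[ℝ] F →L[ℝ] ℝ} {f : E → ℝ}
  {UB : Set E} {UF : Set F} {x : E} {y : F}

omit [FiniteDimensional ℝ E] [FiniteDimensional ℝ F] in
lemma hasFDerivAt_comp_fst {V : Type*} [NormedAddCommGroup V] [NormedSpace ℝ V] {φ : E → V}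
    (h : DifferentiableAt ℝ φ x) (y : F) : HasFDerivAt (fun v : E × F => φ v.1)
      ((fderiv ℝ φ x).comp (ContinuousLinearMap.fst ℝ E F)) (x, y) :=
  HasFDerivAt.comp (g := φ) (x, y) h.hasFDerivAt hasFDerivAt_fst

omit [FiniteDimensional ℝ E] [FiniteDimensional ℝ F] in
lemma hasFDerivAt_comp_snd {V : Type*} [NormedAddCommGroup V] [NormedSpace ℝ V] {φ : F → V}
    (h : DifferentiableAt ℝ φ y) (x : E) : HasFDerivAt (fun v : E × F => φ v.2)
      ((fderiv ℝ φ y).comp (ContinuousLinearMap.snd ℝ E F)) (x, y) :=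
  HasFDerivAt.comp (g := φ) (x, y) h.hasFDerivAt hasFDerivAt_snd

lemma fderiv_GamL_warp (h : WarpData gB gF f UB UF) (hx : x ∈ UB) (hy : y ∈ UF) (a b c : E × F) :
    fderiv ℝ (GamL (warp gB gF f)) (x, y) a b c
      = (fderiv ℝ (GamL gB) x a.1 b.1 c.1
          - (1 / 2 * fderiv ℝ gF y a.2 b.2 c.2) • grad gB f x
          - (1 / 2 * gF y b.2 c.2) • fderiv ℝ (grad gB f) x a.1,
        fderiv ℝ (GamL gF) y a.2 b.2 c.2
          + (1 / (2 * f x)) • (fderiv ℝ (fderiv ℝ f) x a.1 b.1 • c.2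
            + fderiv ℝ (fderiv ℝ f) x a.1 c.1 • b.2)
          - (fderiv ℝ f x a.1 / (2 * f x ^ 2)) • (fderiv ℝ f x b.1 • c.2
            + fderiv ℝ f x c.1 • b.2)) := by
  have hu : (x, y) ∈ UB ×ˢ UF := ⟨hx, hy⟩
  have hf := h.ne_zero x hx
  have heq : (fun v => GamL (warp gB gF f) v b c) =ᶠ[nhds (x, y)] fun v =>
      (GamL gB v.1 b.1 c.1 - (1 / 2 * gF v.2 b.2 c.2) • grad gB f v.1,
        GamL gF v.2 b.2 c.2
          + (2 * f v.1)⁻¹ • (fderiv ℝ f v.1 b.1 • c.2 + fderiv ℝ f v.1 c.1 • b.2)) := by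
    filter_upwards [h.localMetric.mem_nhds hu] with v hv
    -- The factor `1 / (2f)` is kept as an inverse in `heq` so that `hasDerivAt_inv` differentiates
    -- it.
    rw [← one_div]
    exact h.GamL_warp hv.1 hv.2 b c
  have hl := ((h.localMetric.differentiableAt_GamL hu).hasFDerivAt.clm_apply
    (hasFDerivAt_const b _)).clm_apply (hasFDerivAt_const c _)
  have h1 := hasFDerivAt_comp_fst (h.base.differentiableAt_GamL hx) y
  have h2 := hasFDerivAt_comp_snd (h.fiber.differentiableAt_GamL hy) x
  have h3 := hasFDerivAt_comp_snd (h.fiber.differentiableAt hy) x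
  have h4 := hasFDerivAt_comp_fst (h.base.differentiableAt_grad hx h.smooth) y
  have h5 := hasFDerivAt_comp_fst (h.base.differentiableAt_fderiv hx h.smooth) y
  have h6 := (hasDerivAt_inv (by simpa using hf)).comp_hasFDerivAt (x, y)
    ((hasFDerivAt_comp_fst (h.base.differentiableAt_fun hx h.smooth) y).const_mul 2)
  have hr := ((((h1.clm_apply (hasFDerivAt_const b.1 _)).clm_apply (hasFDerivAt_const c.1 _)).sub
    ((((h3.clm_apply (hasFDerivAt_const b.2 _)).clm_apply
      (hasFDerivAt_const c.2 _)).const_mul (1 / 2)).smul h4)).prodMk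
    (((h2.clm_apply (hasFDerivAt_const b.2 _)).clm_apply (hasFDerivAt_const c.2 _)).add
      (h6.smul (((h5.clm_apply (hasFDerivAt_const b.1 _)).smul (hasFDerivAt_const c.2 _)).add
        ((h5.clm_apply (hasFDerivAt_const c.1 _)).smul (hasFDerivAt_const b.2 _))))))
  have hh := congrArg (fun L => L a) (hl.unique (hr.congr_of_eventuallyEq heq))
  simp only [add_apply, ContinuousLinearMap.comp_apply, ContinuousLinearMap.flip_apply, zero_apply,
    map_zero, zero_add] at hh
  rw [hh]
  ext
  · simp
    module
  · simp
    module

/-- The `P` term comes from composing the two warping parts of the Christoffel symbols, which pairs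
`df` with `grad f`. The Hessian from the derivative of `grad f` and the `df ⊗ df` terms combine into
`T`. -/
lemma riem_warp (h : WarpData gB gF f UB UF) (hx : x ∈ UB) (hy : y ∈ UF) (a b c d : E × F) :
    riem (warp gB gF f) (x, y) a b c d
      = riem gB x a.1 b.1 c.1 d.1 + f x * riem gF y a.2 b.2 c.2 d.2
        + f x ^ 2 * sP gB f x * (1 / 2 * kn (fun v w => gF y v w) (fun v w => gF y v w)
            a.2 b.2 c.2 d.2)
        - f x * (tT gB f x a.1 d.1 * gF y b.2 c.2 + tT gB f x b.1 c.1 * gF y a.2 d.2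
          - tT gB f x a.1 c.1 * gF y b.2 d.2 - tT gB f x b.1 d.1 * gF y a.2 c.2) := by
  have hu : (x, y) ∈ UB ×ˢ UF := ⟨hx, hy⟩
  have hf := h.ne_zero x hx
  rw [h.localMetric.riem_eq hu, warp_apply]
  simp only [h.fderiv_GamL_warp hx hy, h.GamL_warp hx hy, Prod.fst_sub, Prod.snd_sub, Prod.fst_add,
    Prod.snd_add, map_add, map_sub, map_smul, sub_apply, add_apply, smul_apply, smul_eq_mul,
    h.base.apply_grad hx, h.base.apply_fderiv_grad hx h.smooth, h.base.riem_eq hx,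
    h.fiber.riem_eq hy, kn, tT, h.base.hess_eq hx h.smooth, sP, h.fiber.fderiv_eq hy]
  rw [h.base.fderiv_fderiv_symm hx h.smooth b.1 a.1, h.fiber.symm y hy b.2 a.2,
    h.fiber.GamL_symm hy b.2 a.2, h.fiber.symm y hy (GamL gF y a.2 d.2) b.2,
    h.fiber.symm y hy (GamL gF y b.2 d.2) a.2]
  field_simp
  ring

/-- In a product basis the inverse metric is block diagonal, and its fiber block carries the factor
`1 / f`. -/
lemma contract_warp (h : WarpData gB gF f UB UF) (hx : x ∈ UB) (hy : y ∈ UF)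
    {A : E × F → E × F → ℝ} (hA : IsBilin A) :
    contract (warp gB gF f) (x, y) A = contract gB x (fun X Y => A (X, 0) (Y, 0))
      + 1 / f x * contract gF y (fun V W => A (0, V) (0, W)) := by
  have hu : (x, y) ∈ UB ×ˢ UF := ⟨hx, hy⟩
  have hf := h.ne_zero x hx
  obtain ⟨L, hL⟩ := hA
  have hB : IsBilin fun X Y => A (X, 0) (Y, 0) :=
    ⟨L.compl₁₂ (LinearMap.inl ℝ E F) (LinearMap.inl ℝ E F), fun X Y => by simp [hL]⟩
  have hF : IsBilin fun V W => A (0, V) (0, W) :=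
    ⟨L.compl₁₂ (LinearMap.inr ℝ E F) (LinearMap.inr ℝ E F), fun X Y => by simp [hL]⟩
  rw [h.localMetric.contract_eq_sum hu ⟨L, hL⟩ ((Module.finBasis ℝ E).prod (Module.finBasis ℝ F)),
    h.base.contract_eq_sum hx hB (Module.finBasis ℝ E),
    h.fiber.contract_eq_sum hy hF (Module.finBasis ℝ F), Fintype.sum_sum_type, Finset.mul_sum]
  congr 1
  · refine Finset.sum_congr rfl fun j _ => ?_
    rw [h.localMetric.sharp_eq hu (v := (sharp gB x
      (LinearMap.toContinuousLinearMap ((Module.finBasis ℝ E).coord j)), 0))]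
    · simp
    · intro w
      simp [warp_apply, h.base.apply_sharp hx]
  · refine Finset.sum_congr rfl fun j _ => ?_
    rw [h.localMetric.sharp_eq hu (v := (0, (1 / f x) • sharp gF y
      (LinearMap.toContinuousLinearMap ((Module.finBasis ℝ F).coord j))))]
    · have : ((0 : E), (1 / f x) • sharp gF y
          (LinearMap.toContinuousLinearMap ((Module.finBasis ℝ F).coord j)))
        = (1 / f x) • ((0 : E), sharp gF y
          (LinearMap.toContinuousLinearMap ((Module.finBasis ℝ F).coord j))) := by simp
      rw [this, hL, hL, map_smul, LinearMap.smul_apply, smul_eq_mul]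
      simp
    · intro w
      simp [warp_apply, h.fiber.apply_sharp hy, hf]

lemma ric_warp (h : WarpData gB gF f UB UF) (hx : x ∈ UB) (hy : y ∈ UF) (b c : E × F) :
    ric (warp gB gF f) (x, y) b c
      = ric gB x b.1 c.1 - Module.finrank ℝ F * tT gB f x b.1 c.1 + ric gF y b.2 c.2
        + f x * ((Module.finrank ℝ F - 1) * sP gB f x - trT gB f x) * gF y b.2 c.2 := by
  have hu : (x, y) ∈ UB ×ˢ UF := ⟨hx, hy⟩
  have hf := h.ne_zero x hx
  rw [ric, h.contract_warp hx hy (h.localMetric.isBilin_riem hu b c)]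
  have hB : (fun X Y => riem (warp gB gF f) (x, y) (X, 0) b c (Y, 0)) = fun X Y =>
      riem gB x X b.1 c.1 Y + (-(f x * gF y b.2 c.2)) * tT gB f x X Y := by
    ext X Y
    rw [h.riem_warp hx hy]
    have h0 : riem gF y 0 b.2 c.2 0 = 0 := by
      simpa using h.fiber.riem_smul₁ hy 0 0 b.2 c.2 0
    simp [h0, kn]
    ring
  -- Tracing `g̃(V, W)` gives the fiber dimension `k` and tracing the last product gives back `g̃(b,
  -- c)`: hence `k - 1` in front of `P`, but `k` in front of `T`.
  have hF : (fun V W => riem (warp gB gF f) (x, y) (0, V) b c (0, W)) = fun V W =>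
      f x * riem gF y V b.2 c.2 W
        + ((f x ^ 2 * sP gB f x * gF y b.2 c.2 - f x * tT gB f x b.1 c.1) * gF y V W
        + (-(f x ^ 2 * sP gB f x)) * (gF y V c.2 * gF y W b.2)) := by
    ext V W
    rw [h.riem_warp hx hy]
    have h0 : riem gB x 0 b.1 c.1 0 = 0 := by
      simpa using h.base.riem_smul₁ hx 0 0 b.1 c.1 0
    have h1 : ∀ Y, tT gB f x 0 Y = 0 := fun Y => by
      simpa using h.base.tT_smul₁ hx h.smooth 0 0 Y
    have h2 : ∀ Y, tT gB f x Y 0 = 0 := fun Y => by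
      simpa using h.base.tT_smul₂ hx h.smooth 0 Y 0
    simp [h0, h1, h2, kn]
    rw [h.fiber.symm y hy b.2 W]
    ring
  rw [hB, hF, LocalMetric.contract_add, LocalMetric.contract_const_mul,
    LocalMetric.contract_add, LocalMetric.contract_const_mul, LocalMetric.contract_add,
    LocalMetric.contract_const_mul, LocalMetric.contract_const_mul, h.fiber.contract_metric hy,
    h.fiber.contract_mul hy, h.fiber.symm y hy c.2 b.2]
  simp only [ric, trT]
  have : contract gB x (fun X Y => tT gB f x X Y) = contract gB x (tT gB f x) := rfl
  rw [this]
  field_simp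
  ring

omit [FiniteDimensional ℝ F] in
lemma hasFDerivAt_kn (h : LocalMetric gF UF) (hy : y ∈ UF) (V W V' W' : F) :
    HasFDerivAt (fun v => kn (fun a b => gF v a b) (fun a b => gF v a b) V W V' W')
      (2 • (gF y V W' • ((fderiv ℝ gF y).flip W).flip V'
        + gF y W V' • ((fderiv ℝ gF y).flip V).flip W'
        - gF y V V' • ((fderiv ℝ gF y).flip W).flip W'
        - gF y W W' • ((fderiv ℝ gF y).flip V).flip V')) y := by
  have hg (a b : F) : HasFDerivAt (fun v => gF v a b) (((fderiv ℝ gF y).flip a).flip b) y := by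
    refine (((h.differentiableAt hy).hasFDerivAt.clm_apply (hasFDerivAt_const a y)).clm_apply
      (hasFDerivAt_const b y)).congr_fderiv ?_
    ext; simp
  unfold kn
  refine (((((hg V W').mul (hg W V')).add ((hg W V').mul (hg V W'))).sub
    ((hg V V').mul (hg W W'))).sub ((hg W W').mul (hg V V'))).congr_fderiv ?_
  ext
  simp
  ring

lemma fderiv_riem_warp (h : WarpData gB gF f UB UF) (hx : x ∈ UB) (hy : y ∈ UF)
    (e a b c d : E × F) :
    fderiv ℝ (fun v => riem (warp gB gF f) v a b c d) (x, y) e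
      = fderiv ℝ (fun v => riem gB v a.1 b.1 c.1 d.1) x e.1
        + fderiv ℝ f x e.1 * riem gF y a.2 b.2 c.2 d.2
        + f x * fderiv ℝ (fun v => riem gF v a.2 b.2 c.2 d.2) y e.2
        + (2 * f x * fderiv ℝ f x e.1 * sP gB f x + (f x ^ 2 * dF (sP gB f) x e.1))
          * (1 / 2 * kn (fun v w => gF y v w) (fun v w => gF y v w) a.2 b.2 c.2 d.2)
        + f x ^ 2 * sP gB f x * (gF y a.2 d.2 * fderiv ℝ gF y e.2 b.2 c.2
          + gF y b.2 c.2 * fderiv ℝ gF y e.2 a.2 d.2 - gF y a.2 c.2 * fderiv ℝ gF y e.2 b.2 d.2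
          - gF y b.2 d.2 * fderiv ℝ gF y e.2 a.2 c.2)
        - fderiv ℝ f x e.1 * (tT gB f x a.1 d.1 * gF y b.2 c.2 + tT gB f x b.1 c.1 * gF y a.2 d.2
          - tT gB f x a.1 c.1 * gF y b.2 d.2 - tT gB f x b.1 d.1 * gF y a.2 c.2)
        - f x * (fderiv ℝ (fun v => tT gB f v a.1 d.1) x e.1 * gF y b.2 c.2
          + tT gB f x a.1 d.1 * fderiv ℝ gF y e.2 b.2 c.2
          + (fderiv ℝ (fun v => tT gB f v b.1 c.1) x e.1 * gF y a.2 d.2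
          + tT gB f x b.1 c.1 * fderiv ℝ gF y e.2 a.2 d.2)
          - (fderiv ℝ (fun v => tT gB f v a.1 c.1) x e.1 * gF y b.2 d.2
          + tT gB f x a.1 c.1 * fderiv ℝ gF y e.2 b.2 d.2)
          - (fderiv ℝ (fun v => tT gB f v b.1 d.1) x e.1 * gF y a.2 c.2
          + tT gB f x b.1 d.1 * fderiv ℝ gF y e.2 a.2 c.2)) := by
  have hu : (x, y) ∈ UB ×ˢ UF := ⟨hx, hy⟩
  have hf := h.ne_zero x hx
  have heq : (fun v => riem (warp gB gF f) v a b c d) =ᶠ[nhds (x, y)] fun v =>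
      riem gB v.1 a.1 b.1 c.1 d.1 + f v.1 * riem gF v.2 a.2 b.2 c.2 d.2
        + f v.1 ^ 2 * sP gB f v.1 * (1 / 2 * kn (fun a b => gF v.2 a b) (fun a b => gF v.2 a b)
            a.2 b.2 c.2 d.2)
        - f v.1 * (tT gB f v.1 a.1 d.1 * gF v.2 b.2 c.2 + tT gB f v.1 b.1 c.1 * gF v.2 a.2 d.2
          - tT gB f v.1 a.1 c.1 * gF v.2 b.2 d.2 - tT gB f v.1 b.1 d.1 * gF v.2 a.2 c.2) := by
    filter_upwards [h.localMetric.mem_nhds hu] with v hv using h.riem_warp hv.1 hv.2 a b c d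
  rw [heq.fderiv_eq]
  have h1 := hasFDerivAt_comp_fst (h.base.differentiableAt_riem hx a.1 b.1 c.1 d.1) y
  have h2 := hasFDerivAt_comp_snd (h.fiber.differentiableAt_riem hy a.2 b.2 c.2 d.2) x
  have h3 := hasFDerivAt_comp_fst (h.base.differentiableAt_fun hx h.smooth) y
  have h4 := hasFDerivAt_comp_fst (h.base.differentiableAt_sP hx h.smooth hf) y
  have h5 := hasFDerivAt_comp_snd (hasFDerivAt_kn h.fiber hy a.2 b.2 c.2 d.2).differentiableAt x
  have h6 (X Y : E) := hasFDerivAt_comp_fst (h.base.differentiableAt_tT hx h.smooth hf X Y) y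
  have h7 (V W : F) : HasFDerivAt (fun v : E × F => gF v.2 V W) _ (x, y) :=
    ((hasFDerivAt_comp_snd (h.fiber.differentiableAt hy) x).clm_apply
      (hasFDerivAt_const V _)).clm_apply (hasFDerivAt_const W _)
  have h8 := (((h1.add (h3.mul h2)).add (((h3.pow 2).mul h4).mul (h5.const_mul (1 / 2)))).sub
    (h3.mul (((((h6 a.1 d.1).mul (h7 b.2 c.2)).add ((h6 b.1 c.1).mul (h7 a.2 d.2))).sub
      ((h6 a.1 c.1).mul (h7 b.2 d.2))).sub ((h6 b.1 d.1).mul (h7 a.2 c.2)))))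
  refine (congrArg (fun L => L e) h8.fderiv).trans ?_
  simp [(hasFDerivAt_kn h.fiber hy a.2 b.2 c.2 d.2).fderiv, dF]
  ring

/-- The obstruction to the vanishing of the components `(∇R)(V, X, Y, Z, W)` with `V`, `W`
vertical and `X`, `Y`, `Z` horizontal. -/
def gradDefect (gB : E → E →L[ℝ] E →L[ℝ] ℝ) (f : E → ℝ) (x X Y Z : E) : ℝ :=
  riem gB x X Y Z (grad gB f x) + (dF f x X * tT gB f x Y Z - dF f x Y * tT gB f x X Z)

/-- The obstruction to the vanishing of the components of `∇R` with exactly one horizontal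
argument, in a slot of the curvature tensor. -/
def fiberDefect (gB : E → E →L[ℝ] E →L[ℝ] ℝ) (gF : F → F →L[ℝ] F →L[ℝ] ℝ) (f : E → ℝ) (x : E)
    (y : F) (X : E) (V W V' W' : F) : ℝ :=
  dF f x X * riem gF y V W V' W' - f x ^ 2 * dF (sP gB f) x X
    * (1 / 2 * kn (fun v w => gF y v w) (fun v w => gF y v w) V W V' W')

set_option maxHeartbeats 1000000 in
-- For a horizontal direction, each vertical slot contributes a correction `-df / (2f)`. With four
-- such slots `f R̃` yields `df - 2 df = -df`, while the derivative of `f²` in the `P` term cancels;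
-- with two, the derivative of `f` in the `T` terms cancels. The base part `-½ g̃ grad f` of the
-- symbols puts `grad f` into slots of `R̄` and `T`, and the part `df / (2f)` for a horizontal slot
-- puts the direction into slots of the fiber terms. These contributions form the two defects.
lemma nablaRiem_warp (h : WarpData gB gF f UB UF) (hx : x ∈ UB) (hy : y ∈ UF)
    (e a b c d : E × F) :
    nablaRiem (warp gB gF f) (x, y) e a b c d
      = nablaRiem gB x e.1 a.1 b.1 c.1 d.1 + f x * nablaRiem gF y e.2 a.2 b.2 c.2 d.2
        - dF f x e.1 * riem gF y a.2 b.2 c.2 d.2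
        + f x ^ 2 * dF (sP gB f) x e.1
          * (1 / 2 * kn (fun v w => gF y v w) (fun v w => gF y v w) a.2 b.2 c.2 d.2)
        - f x * (nablaT gB f x e.1 a.1 d.1 * gF y b.2 c.2 + nablaT gB f x e.1 b.1 c.1 * gF y a.2 d.2
          - nablaT gB f x e.1 a.1 c.1 * gF y b.2 d.2 - nablaT gB f x e.1 b.1 d.1 * gF y a.2 c.2)
        + 1 / 2 * (gF y e.2 d.2 * gradDefect gB f x a.1 b.1 c.1
          - gF y e.2 c.2 * gradDefect gB f x a.1 b.1 d.1
          + gF y e.2 b.2 * gradDefect gB f x c.1 d.1 a.1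
          - gF y e.2 a.2 * gradDefect gB f x c.1 d.1 b.1)
        - 1 / 2 * (fiberDefect gB gF f x y a.1 e.2 b.2 c.2 d.2
          + fiberDefect gB gF f x y b.1 a.2 e.2 c.2 d.2
          + fiberDefect gB gF f x y c.1 a.2 b.2 e.2 d.2
          + fiberDefect gB gF f x y d.1 a.2 b.2 c.2 e.2) := by
  have hu : (x, y) ∈ UB ×ˢ UF := ⟨hx, hy⟩
  have hf := h.ne_zero x hx
  have hP (X : E) : f x ^ 2 * fderiv ℝ (sP gB f) x X + f x * tT gB f x X (grad gB f x)
      + f x * fderiv ℝ f x X * sP gB f x = 0 := by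
    have := h.base.sq_mul_dF_sP hx h.smooth h.ne_zero X
    rw [dF] at this
    linear_combination this
  -- The curvature symmetries move `grad f` to the last slot, the form used in `gradDefect`.
  have hR₁ : riem gB x (grad gB f x) b.1 c.1 d.1 = -riem gB x c.1 d.1 b.1 (grad gB f x) := by
    rw [h.base.riem_pair hx, h.base.riem_skew hx]
  have hR₂ : riem gB x a.1 (grad gB f x) c.1 d.1 = riem gB x c.1 d.1 a.1 (grad gB f x) :=
    h.base.riem_pair hx _ _ _ _
  have hR₃ : riem gB x a.1 b.1 (grad gB f x) d.1 = -riem gB x a.1 b.1 d.1 (grad gB f x) :=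
    h.base.riem_skew hx _ _ _ _
  simp only [nablaRiem, h.fderiv_riem_warp hx hy, h.localMetric.Gam_eq hu, h.GamL_warp hx hy,
    h.riem_warp hx hy, h.base.Gam_eq hx, h.fiber.Gam_eq hy, nablaT, gradDefect, fiberDefect,
    h.base.riem_sub₁ hx, h.base.riem_sub₂ hx, h.base.riem_sub₃ hx, h.base.riem_sub₄ hx,
    h.base.riem_smul₁ hx, h.base.riem_smul₂ hx, h.base.riem_smul₃ hx, h.base.riem_smul₄ hx,
    h.fiber.riem_add₁ hy, h.fiber.riem_add₂ hy, h.fiber.riem_add₃ hy, h.fiber.riem_add₄ hy,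
    h.fiber.riem_smul₁ hy, h.fiber.riem_smul₂ hy, h.fiber.riem_smul₃ hy, h.fiber.riem_smul₄ hy,
    h.base.tT_sub₁ hx h.smooth, h.base.tT_sub₂ hx h.smooth, h.base.tT_smul₁ hx h.smooth,
    h.base.tT_smul₂ hx h.smooth, h.fiber.fderiv_eq hy,
    kn, map_add, map_smul, add_apply, smul_apply, smul_eq_mul, dF, hR₁, hR₂, hR₃,
    h.fiber.symm y hy _ (GamL gF y _ _), h.base.tT_symm hx h.smooth (grad gB f x),
    h.base.tT_symm hx h.smooth c.1 a.1, h.base.tT_symm hx h.smooth c.1 b.1,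
    h.base.tT_symm hx h.smooth d.1 a.1, h.base.tT_symm hx h.smooth d.1 b.1,
    h.fiber.symm y hy a.2 e.2, h.fiber.symm y hy b.2 e.2]
  rw [← sub_eq_zero]
  field_simp
  -- The terms left over are `T(·, grad f)` and `P df` against `dP`, once for each slot of the
  -- curvature tensor; `hP` balances them.
  linear_combination 2 * (gF y b.2 d.2 * gF y e.2 c.2 - gF y b.2 c.2 * gF y e.2 d.2) * hP a.1
    + 2 * (gF y a.2 c.2 * gF y e.2 d.2 - gF y a.2 d.2 * gF y e.2 c.2) * hP b.1
    + 2 * (gF y b.2 d.2 * gF y e.2 a.2 - gF y a.2 d.2 * gF y e.2 b.2) * hP c.1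
    + 2 * (gF y a.2 c.2 * gF y e.2 b.2 - gF y b.2 c.2 * gF y e.2 a.2) * hP d.1

end WarpData

end Coord

/-! ### Splitting the equation into components -/

namespace Coord

namespace LocalMetric

variable {E : Type*} [NormedAddCommGroup E] [NormedSpace ℝ E] [FiniteDimensional ℝ E]
  {G : E → E →L[ℝ] E →L[ℝ] ℝ} {U : Set E} {u : E} {f : E → ℝ}

lemma riem_zero₁ (h : LocalMetric G U) (hu : u ∈ U) (Y Z W : E) : riem G u 0 Y Z W = 0 := by
  simpa using h.riem_smul₁ hu 0 0 Y Z W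

lemma riem_zero₂ (h : LocalMetric G U) (hu : u ∈ U) (Y Z W : E) : riem G u Y 0 Z W = 0 := by
  simpa using h.riem_smul₂ hu 0 0 Y Z W

lemma riem_zero₃ (h : LocalMetric G U) (hu : u ∈ U) (Y Z W : E) : riem G u Y Z 0 W = 0 := by
  simpa using h.riem_smul₃ hu 0 0 Y Z W

lemma riem_zero₄ (h : LocalMetric G U) (hu : u ∈ U) (Y Z W : E) : riem G u Y Z W 0 = 0 := by
  simpa using h.riem_smul₄ hu 0 0 Y Z W

omit [FiniteDimensional ℝ E] in
-- Disposes of the derivative term when a covariant derivative is evaluated with a zero argument.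
lemma fderiv_eq_zero (h : LocalMetric G U) (hu : u ∈ U) {φ : E → ℝ} (hφ : ∀ v ∈ U, φ v = 0) :
    fderiv ℝ φ u = 0 := by
  have : φ =ᶠ[nhds u] fun _ => 0 := by
    filter_upwards [h.mem_nhds hu] with v hv using hφ v hv
  rw [this.fderiv_eq, fderiv_fun_const]
  rfl

lemma nablaRiem_zero₀ (h : LocalMetric G U) (hu : u ∈ U) (X Y Z W : E) :
    nablaRiem G u 0 X Y Z W = 0 := by
  simp [nablaRiem, h.Gam_eq hu, h.riem_zero₁ hu, h.riem_zero₂ hu, h.riem_zero₃ hu, h.riem_zero₄ hu]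

lemma nablaRiem_zero₁ (h : LocalMetric G U) (hu : u ∈ U) (D Y Z W : E) :
    nablaRiem G u D 0 Y Z W = 0 := by
  simp [nablaRiem, h.Gam_eq hu, h.riem_zero₁ hu,
    h.fderiv_eq_zero hu fun v hv => h.riem_zero₁ hv Y Z W]

lemma nablaRiem_zero₂ (h : LocalMetric G U) (hu : u ∈ U) (D Y Z W : E) :
    nablaRiem G u D Y 0 Z W = 0 := by
  simp [nablaRiem, h.Gam_eq hu, h.riem_zero₂ hu,
    h.fderiv_eq_zero hu fun v hv => h.riem_zero₂ hv Y Z W]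

omit [FiniteDimensional ℝ E] in
lemma tT_zero₁ (h : LocalMetric G U) (hu : u ∈ U) (hf : ContDiffOn ℝ ∞ f U) (Y : E) :
    tT G f u 0 Y = 0 := by
  simpa using h.tT_smul₁ hu hf 0 0 Y

omit [FiniteDimensional ℝ E] in
lemma tT_zero₂ (h : LocalMetric G U) (hu : u ∈ U) (hf : ContDiffOn ℝ ∞ f U) (Y : E) :
    tT G f u Y 0 = 0 := by
  simpa using h.tT_smul₂ hu hf 0 Y 0

omit [FiniteDimensional ℝ E] in
lemma nablaT_zero₀ (h : LocalMetric G U) (hu : u ∈ U) (hf : ContDiffOn ℝ ∞ f U) (X Y : E) :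
    nablaT G f u 0 X Y = 0 := by
  simp [nablaT, h.Gam_eq hu, h.tT_zero₁ hu hf, h.tT_zero₂ hu hf]

omit [FiniteDimensional ℝ E] in
lemma nablaT_zero₁ (h : LocalMetric G U) (hu : u ∈ U) (hf : ContDiffOn ℝ ∞ f U) (D Y : E) :
    nablaT G f u D 0 Y = 0 := by
  simp [nablaT, h.Gam_eq hu, h.tT_zero₁ hu hf,
    h.fderiv_eq_zero hu fun v hv => h.tT_zero₁ hv hf Y]

omit [FiniteDimensional ℝ E] in
lemma nablaT_zero₂ (h : LocalMetric G U) (hu : u ∈ U) (hf : ContDiffOn ℝ ∞ f U) (D Y : E) :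
    nablaT G f u D Y 0 = 0 := by
  simp [nablaT, h.Gam_eq hu, h.tT_zero₂ hu hf,
    h.fderiv_eq_zero hu fun v hv => h.tT_zero₂ hv hf Y]

lemma ric_zero₁ (h : LocalMetric G U) (hu : u ∈ U) (Y : E) : ric G u 0 Y = 0 := by
  simp [ric, contract, h.riem_zero₂ hu]

lemma ric_zero₂ (h : LocalMetric G U) (hu : u ∈ U) (Y : E) : ric G u Y 0 = 0 := by
  simp [ric, contract, h.riem_zero₃ hu]

end LocalMetric

namespace WarpData

variable {E F : Type*} [NormedAddCommGroup E] [NormedSpace ℝ E] [FiniteDimensional ℝ E]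
  [NormedAddCommGroup F] [NormedSpace ℝ F] [FiniteDimensional ℝ F]
  {gB : E → E →L[ℝ] E →L[ℝ] ℝ} {gF : F → F →L[ℝ] F →L[ℝ] ℝ} {f : E → ℝ}
  {UB : Set E} {UF : Set F} {x : E} {y : F}

/-- The eight conditions are the components on pure vectors. In the other direction they recombine
linearly, since the closed formulas for both sides are sums of exactly these components. -/
lemma equation_iff [Nontrivial F] (h : WarpData gB gF f UB UF) (hx : x ∈ UB) (hy : y ∈ UF)
    (α β : E × F →L[ℝ] ℝ) {k Q : ℝ} (hk : k = Module.finrank ℝ F)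
    (hQ : Q = f x * ((k - 1) * sP gB f x - trT gB f x)) :
    (∀ e a b c d : E × F, nablaRiem (warp gB gF f) (x, y) e a b c d
      = α e * riem (warp gB gF f) (x, y) a b c d
        + β e * kn (ric (warp gB gF f) (x, y)) (ric (warp gB gF f) (x, y)) a b c d) ↔
    (∀ D X Y Z W : E, nablaRiem gB x D X Y Z W
      = α (D, 0) * riem gB x X Y Z W + β (D, 0) * kn (ric gB x) (ric gB x) X Y Z W
        - 2 * k * β (D, 0) * kn (ric gB x) (tT gB f x) X Y Z W
        + k ^ 2 * β (D, 0) * kn (tT gB f x) (tT gB f x) X Y Z W) ∧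
    (∀ (D : F) (X Y Z W : E), -(α (0, D) * riem gB x X Y Z W)
      = β (0, D) * kn (ric gB x) (ric gB x) X Y Z W
        - 2 * k * β (0, D) * kn (ric gB x) (tT gB f x) X Y Z W
        + k ^ 2 * β (0, D) * kn (tT gB f x) (tT gB f x) X Y Z W) ∧
    (∀ (D : E) (X Y Z W : F), -(dF f x D + f x * α (D, 0)) * riem gF y X Y Z W
      = β (D, 0) * kn (ric gF y) (ric gF y) X Y Z W
        + 2 * Q * β (D, 0) * kn (fun v w => gF y v w) (ric gF y) X Y Z W
        + (1 / 2 * f x ^ 2 * (sP gB f x * α (D, 0) - dF (sP gB f) x D) + Q ^ 2 * β (D, 0))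
          * kn (fun v w => gF y v w) (fun v w => gF y v w) X Y Z W) ∧
    (∀ D X Y Z W : F, f x * nablaRiem gF y D X Y Z W
      = f x * α (0, D) * riem gF y X Y Z W
        + β (0, D) * kn (ric gF y) (ric gF y) X Y Z W
        + 2 * Q * β (0, D) * kn (fun v w => gF y v w) (ric gF y) X Y Z W
        + (1 / 2 * f x ^ 2 * sP gB f x * α (0, D) + Q ^ 2 * β (0, D))
          * kn (fun v w => gF y v w) (fun v w => gF y v w) X Y Z W) ∧
    (∀ (D X Y : E) (V U : F), 2 * β (D, 0) * (ric gB x X Y - k * tT gB f x X Y) * ric gF y V U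
      = -(f x * (nablaT gB f x D X Y - α (D, 0) * tT gB f x X Y)
        + 2 * Q * β (D, 0) * (ric gB x X Y - k * tT gB f x X Y)) * gF y V U) ∧
    (∀ (D : F) (X Y : E) (V U : F),
      2 * β (0, D) * (ric gB x X Y - k * tT gB f x X Y) * ric gF y V U
      = -(-(f x * α (0, D) * tT gB f x X Y)
        + 2 * Q * β (0, D) * (ric gB x X Y - k * tT gB f x X Y)) * gF y V U) ∧
    (∀ X Y Z : E, riem gB x X Y Z (grad gB f x)
      = -(dF f x X * tT gB f x Y Z - dF f x Y * tT gB f x X Z)) ∧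
    (∀ (D : E) (X Y Z W : F), dF f x D * riem gF y X Y Z W
      = f x ^ 2 * dF (sP gB f) x D
        * (1 / 2 * kn (fun v w => gF y v w) (fun v w => gF y v w) X Y Z W)) := by
  have hS (b c : E × F) : ric (warp gB gF f) (x, y) b c
      = ric gB x b.1 c.1 - k * tT gB f x b.1 c.1 + ric gF y b.2 c.2 + Q * gF y b.2 c.2 := by
    rw [h.ric_warp hx hy, hQ, hk]
  have hdF0 (φ : E → ℝ) : dF φ x 0 = 0 := by simp [dF]
  constructor
  · intro H
    have H' := H
    simp only [h.nablaRiem_warp hx hy, h.riem_warp hx hy, hS, kn, gradDefect, fiberDefect] at H'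
    refine ⟨fun D X Y Z W => ?_, fun D X Y Z W => ?_, fun D X Y Z W => ?_, fun D X Y Z W => ?_,
      fun D X Y V U => ?_, fun D X Y V U => ?_, fun X Y Z => ?_, fun D X Y Z W => ?_⟩
    · have := H' (D, 0) (X, 0) (Y, 0) (Z, 0) (W, 0)
      simp [h.fiber.riem_zero₁ hy, h.fiber.nablaRiem_zero₁ hy, h.fiber.ric_zero₁ hy] at this
      simp only [kn]
      linear_combination this
    · have := H' (0, D) (X, 0) (Y, 0) (Z, 0) (W, 0)
      simp [hdF0, h.fiber.riem_zero₁ hy, h.fiber.riem_zero₂ hy, h.fiber.nablaRiem_zero₁ hy,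
        h.base.nablaRiem_zero₀ hx, h.fiber.ric_zero₁ hy, h.base.nablaT_zero₀ hx h.smooth] at this
      simp only [kn]
      linear_combination this
    · have := H' (D, 0) (0, X) (0, Y) (0, Z) (0, W)
      simp [hdF0, h.base.riem_zero₁ hx, h.base.nablaRiem_zero₁ hx, h.fiber.nablaRiem_zero₀ hy,
        h.base.ric_zero₁ hx, h.base.nablaT_zero₁ hx h.smooth, h.base.tT_zero₁ hx h.smooth] at this
      simp only [kn]
      linear_combination this
    · have := H' (0, D) (0, X) (0, Y) (0, Z) (0, W)
      simp [hdF0, h.base.riem_zero₁ hx, h.base.nablaRiem_zero₁ hx,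
        h.base.ric_zero₁ hx, h.base.nablaT_zero₁ hx h.smooth, h.base.tT_zero₁ hx h.smooth] at this
      simp only [kn]
      linear_combination this
    -- In this slot order the curvature is `f T(X, Y) g̃(V, U)` and `S ∧ S` is `-2 S(X, Y) S(V, U)`.
    · have := H' (D, 0) (X, 0) (0, V) (Y, 0) (0, U)
      simp [hdF0, h.base.riem_zero₂ hx, h.base.nablaRiem_zero₂ hx, h.fiber.nablaRiem_zero₁ hy,
        h.fiber.riem_zero₁ hy, h.fiber.ric_zero₁ hy, h.fiber.ric_zero₂ hy,
        h.base.ric_zero₁ hx, h.base.ric_zero₂ hx, h.base.nablaT_zero₁ hx h.smooth,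
        h.base.nablaT_zero₂ hx h.smooth,
        h.base.tT_zero₁ hx h.smooth, h.base.tT_zero₂ hx h.smooth] at this
      linear_combination this
    · have := H' (0, D) (X, 0) (0, V) (Y, 0) (0, U)
      simp [hdF0, h.base.riem_zero₂ hx, h.base.nablaRiem_zero₂ hx, h.fiber.nablaRiem_zero₁ hy,
        h.fiber.riem_zero₁ hy, h.fiber.riem_zero₃ hy, h.fiber.ric_zero₁ hy, h.fiber.ric_zero₂ hy,
        h.base.ric_zero₁ hx, h.base.ric_zero₂ hx, h.base.nablaT_zero₀ hx h.smooth,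
        h.base.tT_zero₁ hx h.smooth, h.base.tT_zero₂ hx h.smooth] at this
      linear_combination this
    -- Here the right side vanishes and the left is `½ g̃(V, U)` times the defect, so a pair with
    -- `g̃(V, U) ≠ 0` is needed. It exists because the fiber has positive dimension.
    · obtain ⟨V, hV⟩ := exists_ne (0 : F)
      obtain ⟨U, hU⟩ : ∃ U, gF y V U ≠ 0 := by
        by_contra! hU
        exact hV (h.fiber.nondegenerate y hy V hU)
      have := H' (0, V) (X, 0) (Y, 0) (Z, 0) (0, U)
      simp [hdF0, h.base.riem_zero₄ hx, h.base.nablaRiem_zero₀ hx, h.fiber.nablaRiem_zero₁ hy,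
        h.fiber.riem_zero₁ hy, h.fiber.riem_zero₂ hy, h.fiber.ric_zero₁ hy,
        h.base.ric_zero₂ hx, h.base.nablaT_zero₀ hx h.smooth,
        h.base.tT_zero₁ hx h.smooth, h.base.tT_zero₂ hx h.smooth, hU] at this
      linear_combination this
    -- With `D` the only horizontal argument, the right side vanishes and the left is `-½` times the
    -- fiber defect.
    · have := H' (0, X) (D, 0) (0, Y) (0, Z) (0, W)
      simp [hdF0, h.base.riem_zero₂ hx, h.base.nablaRiem_zero₀ hx,
        h.fiber.nablaRiem_zero₁ hy,
        h.fiber.riem_zero₁ hy, h.fiber.ric_zero₁ hy,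
        h.base.ric_zero₁ hx, h.base.ric_zero₂ hx, h.base.nablaT_zero₀ hx h.smooth,
        h.base.tT_zero₁ hx h.smooth, h.base.tT_zero₂ hx h.smooth] at this
      simp only [kn]
      linear_combination this
  · rintro ⟨h1, h2, h3, h4, h5, h6, h7, h8⟩ e a b c d
    have hgd (X Y Z : E) : gradDefect gB f x X Y Z = 0 := by
      rw [gradDefect, h7]; ring
    have hfd (D : E) (X Y Z W : F) : fiberDefect gB gF f x y D X Y Z W = 0 := by
      rw [fiberDefect, h8]; ring
    have hsplit (γ : E × F →L[ℝ] ℝ) : γ e = γ (e.1, 0) + γ (0, e.2) := by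
      rw [← map_add]; simp
    rw [h.nablaRiem_warp hx hy, h.riem_warp hx hy, hsplit α, hsplit β]
    simp only [hgd, hfd]
    have g1 := h1 e.1 a.1 b.1 c.1 d.1
    have g2 := h2 e.2 a.1 b.1 c.1 d.1
    have g3 := h3 e.1 a.2 b.2 c.2 d.2
    have g4 := h4 e.2 a.2 b.2 c.2 d.2
    simp only [kn, hS] at g1 g2 g3 g4 ⊢
    -- The mixed conditions enter for the four pairings of a Kulkarni–Nomizu product, with its signs
    -- reversed because `T` appears in the curvature as `-f (T ∧ g̃)`.
    linear_combination g1 + g2 + g3 + g4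
      - h5 e.1 a.1 d.1 b.2 c.2 - h5 e.1 b.1 c.1 a.2 d.2
      + h5 e.1 a.1 c.1 b.2 d.2 + h5 e.1 b.1 d.1 a.2 c.2
      - h6 e.2 a.1 d.1 b.2 c.2 - h6 e.2 b.1 c.1 a.2 d.2
      + h6 e.2 a.1 c.1 b.2 d.2 + h6 e.2 b.1 d.1 a.2 c.2

end WarpData

end Coord

lemma nondegenerate_bilinearComp {E : Type*} [NormedAddCommGroup E] [NormedSpace ℝ E]
    {B : E →L[ℝ] E →L[ℝ] ℝ} {L : E →L[ℝ] E} (hL : L.IsInvertible)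
    (hB : ∀ v, (∀ w, B v w = 0) → v = 0) (v : E) (hv : ∀ w, B.bilinearComp L L v w = 0) :
    v = 0 := by
  obtain ⟨e, rfl⟩ := hL
  have := hB (e v) fun w => by simpa using hv (e.symm w)
  simpa using this

/-! ### Chart expressions of metrics and functions on a manifold -/

section Chart

variable {E H : Type*} [NormedAddCommGroup E] [NormedSpace ℝ E] [FiniteDimensional ℝ E]
  [TopologicalSpace H] {I : ModelWithCorners ℝ E H} [I.Boundaryless]
  {M : Type*} [TopologicalSpace M] [ChartedSpace H M] [IsManifold I ∞ M]
  {g : BilinField I M} {x₀ : M} {u : E} {f : M → ℝ}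

omit [FiniteDimensional ℝ E] in
-- Links the derivative of the inverse chart to the tangent bundle trivialization, from which its
-- smoothness in `u` is obtained. Without boundary, derivatives within the range of the model are
-- plain derivatives.
lemma chartSymmDeriv_eq_symmL (hu : u ∈ (extChartAt I x₀).target) :
    chartSymmDeriv I x₀ u = (trivializationAt E (TangentSpace I) x₀).symmL ℝ
      ((extChartAt I x₀).symm u) := by
  rw [TangentBundle.symmL_trivializationAt
    (by simpa using (extChartAt I x₀).map_target hu), I.range_eq_univ, mfderivWithin_univ,
    (extChartAt I x₀).right_inv hu]
  rfl

omit [FiniteDimensional ℝ E] in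
lemma isInvertible_chartSymmDeriv (hu : u ∈ (extChartAt I x₀).target) :
    (chartSymmDeriv I x₀ u).IsInvertible := by
  have := isInvertible_mfderivWithin_extChartAt_symm (I := I) hu
  rwa [I.range_eq_univ, mfderivWithin_univ] at this

omit [FiniteDimensional ℝ E] in
-- This justifies reading coordinate tensors at the centre of the chart as tensors on the tangent
-- space.
lemma chartSymmDeriv_self (x : M) : chartSymmDeriv I x (extChartAt I x x) = .id ℝ E := by
  have := mfderivWithin_range_extChartAt_symm (I := I) (x := x)
  rwa [I.range_eq_univ, mfderivWithin_univ] at this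

omit [FiniteDimensional ℝ E] in
lemma contMDiffOn_chartSymmDeriv (X : E) :
    ContMDiffOn 𝓘(ℝ, E) (I.prod 𝓘(ℝ, E)) ∞ (fun u => TotalSpace.mk' E
      (E := fun x : M => TangentSpace I x) ((extChartAt I x₀).symm u) (chartSymmDeriv I x₀ u X))
      (extChartAt I x₀).target := by
  have h1 := (trivializationAt E (TangentSpace I) x₀).contMDiffOn_symm (IB := I) (n := ∞)
  have h2 : ContMDiffOn 𝓘(ℝ, E) (I.prod 𝓘(ℝ, E)) ∞
      (fun u => ((extChartAt I x₀).symm u, X)) (extChartAt I x₀).target :=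
    (contMDiffOn_extChartAt_symm x₀).prodMk contMDiffOn_const
  have hb : ∀ u ∈ (extChartAt I x₀).target,
      (extChartAt I x₀).symm u ∈ (trivializationAt E (TangentSpace I) x₀).baseSet := fun u hu => by
    simpa using (extChartAt I x₀).map_target hu
  refine (h1.comp h2 fun u hu => ?_).congr fun u hu => ?_
  · simpa [Trivialization.mem_target] using hb u hu
  · have hs : chartSymmDeriv I x₀ u X
        = (trivializationAt E (TangentSpace I) x₀).symm ((extChartAt I x₀).symm u) X :=
      (congrArg (fun L : E →L[ℝ] E => L X) (chartSymmDeriv_eq_symmL hu)).trans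
        (Trivialization.symmL_apply _ (hb u hu) X)
    exact (congrArg (TotalSpace.mk' E ((extChartAt I x₀).symm u)) hs).trans
      (Trivialization.mk_symm _ (hb u hu) X)

omit [FiniteDimensional ℝ E] [I.Boundaryless] [IsManifold I ∞ M] in
lemma chartMetric_apply (X Y : E) : chartMetric g x₀ u X Y
    = formAt g ((extChartAt I x₀).symm u) (chartSymmDeriv I x₀ u X) (chartSymmDeriv I x₀ u Y) := by
  rw [chartMetric, ContinuousLinearMap.bilinearComp_apply]

lemma contDiffOn_chartMetric (hg : IsSemiRiemannianMetric g) (x₀ : M) :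
    ContDiffOn ℝ ∞ (chartMetric g x₀) (extChartAt I x₀).target := by
  rw [contDiffOn_clm_apply]
  intro X
  rw [contDiffOn_clm_apply]
  intro Y
  have hgs : ContMDiffOn 𝓘(ℝ, E) (I.prod 𝓘(ℝ, E →L[ℝ] E →L[ℝ] ℝ)) ∞
      (fun u => TotalSpace.mk' (E →L[ℝ] E →L[ℝ] ℝ)
        (E := fun x : M => TangentSpace I x →L[ℝ] TangentSpace I x →L[ℝ] ℝ)
        ((extChartAt I x₀).symm u) (g ((extChartAt I x₀).symm u)))
      (extChartAt I x₀).target :=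
    hg.contMDiff.comp_contMDiffOn (contMDiffOn_extChartAt_symm x₀)
  have : ContMDiffOn 𝓘(ℝ, E) (I.prod 𝓘(ℝ)) ∞
      (fun u => TotalSpace.mk' ℝ (E := Bundle.Trivial M ℝ) ((extChartAt I x₀).symm u)
        (g ((extChartAt I x₀).symm u) (chartSymmDeriv I x₀ u X) (chartSymmDeriv I x₀ u Y)))
      (extChartAt I x₀).target := by
    apply ContMDiffOn.clm_bundle_apply₂ (F₁ := E) (F₂ := E)
    · exact hgs
    · exact contMDiffOn_chartSymmDeriv X
    · exact contMDiffOn_chartSymmDeriv Y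
  rw [← contMDiffOn_iff_contDiffOn]
  intro u hu
  have h2 := this u hu
  -- Smoothness of a section of the trivial line bundle contains smoothness of its fiber coordinate,
  -- the function wanted.
  simp only [contMDiffWithinAt_totalSpace] at h2
  exact h2.2

lemma localMetric_chartMetric (hg : IsSemiRiemannianMetric g) (x₀ : M) :
    Coord.LocalMetric (chartMetric g x₀) (extChartAt I x₀).target where
  isOpen := isOpen_extChartAt_target x₀
  contDiffOn := contDiffOn_chartMetric hg x₀
  symm u _ v w := by
    rw [chartMetric_apply, chartMetric_apply]
    exact hg.symm ((extChartAt I x₀).symm u) _ _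
  nondegenerate u hu := nondegenerate_bilinearComp (isInvertible_chartSymmDeriv hu)
    (hg.nondegenerate ((extChartAt I x₀).symm u))

omit [FiniteDimensional ℝ E] [I.Boundaryless] in
lemma contDiffOn_chartFun (hf : ContMDiff I 𝓘(ℝ, ℝ) ∞ f) (x₀ : M) :
    ContDiffOn ℝ ∞ (chartFun I f x₀) (extChartAt I x₀).target := by
  rw [← contMDiffOn_iff_contDiffOn]
  exact hf.comp_contMDiffOn (contMDiffOn_extChartAt_symm x₀)

omit [FiniteDimensional ℝ E] in
lemma chartMetric_self (x : M) (X Y : E) :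
    chartMetric g x (extChartAt I x x) X Y = metricTensor g x X Y := by
  rw [chartMetric, chartSymmDeriv_self, extChartAt_to_inv]
  rfl

omit [FiniteDimensional ℝ E] [IsManifold I ∞ M] in
lemma dFun_eq (hf : ContMDiff I 𝓘(ℝ, ℝ) ∞ f) (x : M) (X : E) :
    dFun I f x X = Coord.dF (chartFun I f x) (extChartAt I x x) X := by
  change mfderiv I 𝓘(ℝ, ℝ) f x X = _
  rw [(hf.mdifferentiableAt (by simp) : MDifferentiableAt I 𝓘(ℝ, ℝ) f x).mfderiv,
    I.range_eq_univ, fderivWithin_univ]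
  rfl

end Chart

/-! ### Product charts and transfer to the warped product manifold -/

section Warped

variable {E H : Type*} [NormedAddCommGroup E] [NormedSpace ℝ E] [FiniteDimensional ℝ E]
  [TopologicalSpace H] {I : ModelWithCorners ℝ E H} [I.Boundaryless]
  {M : Type*} [TopologicalSpace M] [ChartedSpace H M] [IsManifold I ∞ M]
  {F H' : Type*} [NormedAddCommGroup F] [NormedSpace ℝ F] [FiniteDimensional ℝ F]
  [TopologicalSpace H'] {J : ModelWithCorners ℝ F H'} [J.Boundaryless]
  {N : Type*} [TopologicalSpace N] [ChartedSpace H' N] [IsManifold J ∞ N]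
  {gB : BilinField I M} {gF : BilinField J N} {f : M → ℝ}

omit [FiniteDimensional ℝ E] [FiniteDimensional ℝ F] in
lemma chartSymmDeriv_prod {q : M × N} {u : E × F} (hu₁ : u.1 ∈ (extChartAt I q.1).target)
    (hu₂ : u.2 ∈ (extChartAt J q.2).target) (a : E × F) :
    chartSymmDeriv (I.prod J) q u a
      = (chartSymmDeriv I q.1 u.1 a.1, chartSymmDeriv J q.2 u.2 a.2) := by
  have h1 : MDifferentiableAt 𝓘(ℝ, E) I (extChartAt I q.1).symm u.1 :=
    ((contMDiffOn_extChartAt_symm (n := ∞) q.1).contMDiffAt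
      ((isOpen_extChartAt_target q.1).mem_nhds hu₁)).mdifferentiableAt (by simp)
  have h2 : MDifferentiableAt 𝓘(ℝ, F) J (extChartAt J q.2).symm u.2 :=
    ((contMDiffOn_extChartAt_symm (n := ∞) q.2).contMDiffAt
      ((isOpen_extChartAt_target q.2).mem_nhds hu₂)).mdifferentiableAt (by simp)
  have := mfderiv_prodMap (p := u) h1 h2
  -- The model on `E × F` has to be seen as a product of models before `mfderiv_prodMap` matches.
  rw [chartSymmDeriv, extChartAt_prod, modelWithCornersSelf_prod, ← chartedSpaceSelf_prod]
  exact congrArg (fun L => L a) this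

omit [FiniteDimensional ℝ E] [I.Boundaryless] [IsManifold I ∞ M] [FiniteDimensional ℝ F]
  [J.Boundaryless] [IsManifold J ∞ N] in
lemma formAt_warpedMetric (p : M) (r : N) (a b : E × F) :
    formAt (warpedMetric gB gF f) (p, r) a b
      = formAt gB p a.1 b.1 + f p * formAt gF r a.2 b.2 := by
  have h1 : projBase I J (p, r) = ContinuousLinearMap.fst ℝ E F := mfderiv_fst
  have h2 : projFiber I J (p, r) = ContinuousLinearMap.snd ℝ E F := mfderiv_snd
  change warpedForm gB gF f (p, r) a b = _
  simp [warpedForm, h1, h2]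

omit [FiniteDimensional ℝ E] [FiniteDimensional ℝ F] in
-- Charts of the product are products of charts, so the inverse chart and its derivative split. The
-- equality is obtained on the product of the two chart targets, a neighbourhood of the point.
lemma chartMetric_warped_eventuallyEq (q : M × N) :
    chartMetric (warpedMetric gB gF f) q =ᶠ[nhds (extChartAt (I.prod J) q q)]
      Coord.warp (chartMetric gB q.1) (chartMetric gF q.2) (chartFun I f q.1) := by
  have hm : (extChartAt I q.1).target ×ˢ (extChartAt J q.2).target
      ∈ nhds (extChartAt (I.prod J) q q) := by
    rw [extChartAt_prod]
    exact prod_mem_nhds (extChartAt_target_mem_nhds q.1) (extChartAt_target_mem_nhds q.2)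
  filter_upwards [hm] with u hu
  refine ContinuousLinearMap.ext fun a => ContinuousLinearMap.ext fun b => ?_
  rw [Coord.warp_apply]
  simp only [chartMetric_apply, chartSymmDeriv_prod hu.1 hu.2]
  rw [extChartAt_prod]
  exact formAt_warpedMetric _ _ _ _

lemma warpData_chart (hgB : IsSemiRiemannianMetric gB) (hgF : IsSemiRiemannianMetric gF)
    (hf : ContMDiff I 𝓘(ℝ, ℝ) ∞ f) (hfpos : ∀ x, 0 < f x) (q : M × N) :
    Coord.WarpData (chartMetric gB q.1) (chartMetric gF q.2) (chartFun I f q.1)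
      (extChartAt I q.1).target (extChartAt J q.2).target where
  base := localMetric_chartMetric hgB q.1
  fiber := localMetric_chartMetric hgF q.2
  smooth := contDiffOn_chartFun hf q.1
  ne_zero _ _ := (hfpos _).ne'

lemma wgkEquationAt_iff_coord (Pi Phi : CovField (I.prod J) (M × N)) (q : M × N) :
    WGKEquationAt (warpedMetric gB gF f) Pi Phi q ↔
      ∀ e a b c d : E × F,
        Coord.nablaRiem (Coord.warp (chartMetric gB q.1) (chartMetric gF q.2) (chartFun I f q.1))
          (extChartAt I q.1 q.1, extChartAt J q.2 q.2) e a b c d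
        = (Pi q : E × F →L[ℝ] ℝ) e
            * Coord.riem (Coord.warp (chartMetric gB q.1) (chartMetric gF q.2) (chartFun I f q.1))
              (extChartAt I q.1 q.1, extChartAt J q.2 q.2) a b c d
          + (Phi q : E × F →L[ℝ] ℝ) e * kn
            (Coord.ric (Coord.warp (chartMetric gB q.1) (chartMetric gF q.2) (chartFun I f q.1))
              (extChartAt I q.1 q.1, extChartAt J q.2 q.2))
            (Coord.ric (Coord.warp (chartMetric gB q.1) (chartMetric gF q.2) (chartFun I f q.1))
              (extChartAt I q.1 q.1, extChartAt J q.2 q.2)) a b c d := by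
  have hpt : extChartAt (I.prod J) q q = (extChartAt I q.1 q.1, extChartAt J q.2 q.2) := by
    rw [extChartAt_prod]
    rfl
  have hG := chartMetric_warped_eventuallyEq (I := I) (J := J) (gB := gB) (gF := gF) (f := f) q
  -- Tangent spaces are definitionally the model space, so this only retypes the vectors.
  have h : WGKEquationAt (warpedMetric gB gF f) Pi Phi q ↔ ∀ e a b c d : E × F,
      Coord.nablaRiem (chartMetric (warpedMetric gB gF f) q) (extChartAt (I.prod J) q q) e a b c d
        = (Pi q : E × F →L[ℝ] ℝ) e * Coord.riem (chartMetric (warpedMetric gB gF f) q)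
            (extChartAt (I.prod J) q q) a b c d
          + (Phi q : E × F →L[ℝ] ℝ) e * kn
            (Coord.ric (chartMetric (warpedMetric gB gF f) q) (extChartAt (I.prod J) q q))
            (Coord.ric (chartMetric (warpedMetric gB gF f) q) (extChartAt (I.prod J) q q))
            a b c d := Iff.rfl
  rw [hpt] at hG
  rw [h, hpt]
  simp only [kn, Coord.nablaRiem_congr hG, Coord.riem_congr hG, Coord.ric_congr hG]

theorem wgkEquationAt_iff [Nontrivial F] (hgB : IsSemiRiemannianMetric gB)
    (hgF : IsSemiRiemannianMetric gF) (hf : ContMDiff I 𝓘(ℝ, ℝ) ∞ f) (hfpos : ∀ x, 0 < f x)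
    (Pi Phi : CovField (I.prod J) (M × N)) (q : M × N) :
    WGKEquationAt (warpedMetric gB gF f) Pi Phi q ↔
      WarpedWGKConditionsAt gB gF f Pi Phi q := by
  have hfx : chartFun I f q.1 (extChartAt I q.1 q.1) = f q.1 := by
    rw [chartFun, extChartAt_to_inv]
  have key := (warpData_chart hgB hgF hf hfpos q).equation_iff
    (mem_extChartAt_target q.1) (mem_extChartAt_target q.2)
    (Pi q : E × F →L[ℝ] ℝ) (Phi q : E × F →L[ℝ] ℝ) rfl rfl
  simp only [chartMetric_self, ← dFun_eq hf, hfx] at key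
  refine (wgkEquationAt_iff_coord Pi Phi q).trans (key.trans ?_)
  constructor
  · rintro ⟨h1, h2, h3, h4, h5, h6, h7, h8⟩
    exact ⟨h1, h2, h3, h4, h5, h6, h7, h8⟩
  · rintro ⟨h1, h2, h3, h4, h5, h6, h7, h8⟩
    exact ⟨h1, h2, h3, h4, h5, h6, h7, h8⟩

end Warped

end WarpedProduct

end

theorem corollary4p10
    {E H M F H' N : Type*}
    [NormedAddCommGroup E] [NormedSpace ℝ E] [FiniteDimensional ℝ E] [TopologicalSpace H]
    (I : ModelWithCorners ℝ E H) [I.Boundaryless]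
    [TopologicalSpace M] [ChartedSpace H M] [IsManifold I ∞ M]
    [NormedAddCommGroup F] [NormedSpace ℝ F] [FiniteDimensional ℝ F] [TopologicalSpace H']
    (J : ModelWithCorners ℝ F H') [J.Boundaryless]
    [TopologicalSpace N] [ChartedSpace H' N] [IsManifold J ∞ N]
    (n p : ℕ) (hp : 1 ≤ p) (hpn : p < n)
    (hE : Module.finrank ℝ E = p) (hF : Module.finrank ℝ F = n - p)
    (gB : WarpedProduct.BilinField I M) (hgB : WarpedProduct.IsSemiRiemannianMetric gB)
    (gF : WarpedProduct.BilinField J N) (hgF : WarpedProduct.IsSemiRiemannianMetric gF)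
    (f : M → ℝ) (hf : ContMDiff I 𝓘(ℝ, ℝ) ∞ f) (hfpos : ∀ x, 0 < f x)
    (Pi Phi : WarpedProduct.CovField (I.prod J) (M × N))
    (hPi : WarpedProduct.IsSmoothOneForm Pi) (hPhi : WarpedProduct.IsSmoothOneForm Phi) :
    (WarpedProduct.IsWGK (WarpedProduct.warpedMetric gB gF f) Pi Phi ↔
      ∀ q ∈ WarpedProduct.nonRecurrentSet (WarpedProduct.warpedMetric gB gF f),
        WarpedProduct.WarpedWGKConditionsAt gB gF f Pi Phi q) ∧
    ∀ q : M × N,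
      WarpedProduct.WGKEquationAt (WarpedProduct.warpedMetric gB gF f) Pi Phi q ↔
        WarpedProduct.WarpedWGKConditionsAt gB gF f Pi Phi q := by
  -- The subtraction `n - p` is truncated, but `p < n` makes it positive.
  have : Nontrivial F := Module.nontrivial_of_finrank_pos (R := ℝ) (by omega)
  have h := fun q => WarpedProduct.wgkEquationAt_iff hgB hgF hf hfpos Pi Phi q
  exact ⟨⟨fun hw q hq => (h q).1 (hw.2.2 q hq),
    fun hc => ⟨hPi, hPhi, fun q hq => (h q).2 (hc q hq)⟩⟩, h⟩
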